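/- For a finite simple graph $G$ of order $n$ and $S\subseteq V(G)$, let $B(S)$ be the set of vertices outside $S$ that have a neighbour in $S$. Fix real numbers $k$, $k^{*}$ and $k_1,k_2,\ldots$, and put $w(S)=1$ if $S=\emptyset$ or $|S|$ is odd, and $w(S)=k$ otherwise. For integers $i,j\ge 0$ with $i+j\le n$ let $$B^{(w)}_{i,j}(G)=\begin{cases}0 & \text{if } j=0 \text{ and } i\neq 0,\\ \sum_{|B(S)|=i,\ |S|=j}w(S) & \text{otherwise, if some } S\subseteq V(G) \text{ has } |B(S)|=i,\ |S|=j,\\ \sum_{\ell=1}^{(n-3)/2}k_\ell & \text{otherwise, if } n>3 \text{ is odd},\\ k^{*} & \text{otherwise,}\end{cases}$$ and let $\widetilde B_w(G;x)=\sum_{0\le i+j\le n}B^{(w)}_{i,j}(G)\,x^{i+j}-1$. The $\epsilon$-Liénard system of a graph $G_1$ is $$\frac{dx}{dt}=y-\epsilon\,\widetilde B_w(G_1;x),\qquad \frac{dy}{dt}=-\widetilde B_w(E_1;x)=-x,$$ where $E_m$ and $K_m$ denote the empty and the complete graph on $m$ vertices. A limit cycle is an isolated closed orbit, that is, a closed orbit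 with a neighbourhood that contains no other closed orbit. **Theorem.** Let $m>3$ be odd, let $N=\frac{m-1}{2}$, and let $G_1=K_m$ or $G_1=E_m$. Then, for every choice of the real parameters $k,k^{*},k_\ell$ and all positive real numbers $r_1,\ldots,r_N$, the graph $G_1$ is not associated to $N$ limit cycles asymptotic to the circles of radii $r_1,\ldots,r_N$. That is, there are no families $\Gamma_1(\epsilon),\ldots,\Gamma_N(\epsilon)$ of plane sets such that, for all sufficiently small $\epsilon\ne 0$, $\Gamma_1(\epsilon),\ldots,\Gamma_N(\epsilon)$ are $N$ distinct limit cycles of the $\epsilon$-Liénard system of $G_1$, and such that, for every $j$, $\Gamma_j(\epsilon)$ converges in Hausdorff distance to the circle of radius $r_j$ centred at the origin as $\epsilon\to 0$. In particular, the system never has exactly $N$ limit cycles asymptotic to circles of radii $r_1,\ldots,r_N$. -/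

import Mathlib

open Filter Topology

noncomputable section

namespace BoundaryLienard

/-- The free real parameters of the weighted boundary polynomial: the value `k` of the weight
function on nonempty sets of even size, the numbers `k_ℓ` (only `1 ≤ ℓ ≤ (n - 3) / 2` are used for
a graph of order `n`), and the default value `k*`. -/
structure Weights where
  k : ℝ
  kl : ℕ → ℝ
  kStar : ℝ

/-- The weight function on vertex sets: `1` if `S` is empty or has odd size, `k` otherwise. -/
def Weights.weight (W : Weights) {V : Type*} (S : Finset V) : ℝ :=
  open Classical in if S = ∅ ∨ Odd S.card then 1 else W.k

/-- The outer vertex boundary `B(S)`: the vertices outside `S` that have a neighbour in `S`. -/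
def outerBoundary {V : Type*} [Fintype V] (G : SimpleGraph V) (S : Finset V) : Finset V :=
  open Classical in Finset.univ.filter fun v => v ∉ S ∧ ∃ u ∈ S, G.Adj u v

/-- The vertex sets `S` with `|B(S)| = i` and `|S| = j`. -/
def boundarySets {V : Type*} [Fintype V] (G : SimpleGraph V) (i j : ℕ) : Finset (Finset V) :=
  open Classical in
    Finset.univ.filter fun S : Finset V => (outerBoundary G S).card = i ∧ S.card = j

/-- The coefficient `B^{(w)}_{i,j}(G)` of the weighted boundary polynomial. By convention
`B^{(w)}_{i,0}(G) = 0` for `i ≠ 0`. -/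
def weightedCoeff {V : Type*} [Fintype V] (W : Weights) (G : SimpleGraph V) (i j : ℕ) : ℝ :=
  open Classical in
    if j = 0 ∧ i ≠ 0 then 0
    else if (boundarySets G i j).Nonempty then ∑ S ∈ boundarySets G i j, W.weight S
    else if 3 < Fintype.card V ∧ Odd (Fintype.card V) then
      ∑ l ∈ Finset.Icc 1 ((Fintype.card V - 3) / 2), W.kl l
    else W.kStar

/-- The weighted boundary polynomial `B_w(G; x, y)`, the sum over all `i, j` with
`0 ≤ i + j ≤ n`, `n` the order of `G`. -/
def weightedBoundaryPoly {V : Type*} [Fintype V] (W : Weights) (G : SimpleGraph V)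
    (x y : ℝ) : ℝ :=
  ∑ d ∈ Finset.range (Fintype.card V + 1), ∑ p ∈ Finset.HasAntidiagonal.antidiagonal d,
    weightedCoeff W G p.1 p.2 * x ^ p.1 * y ^ p.2

/-- `B̃_w(G; x) = B_w(G; x, x) - 1`. -/
def reducedPoly {V : Type*} [Fintype V] (W : Weights) (G : SimpleGraph V) (x : ℝ) : ℝ :=
  weightedBoundaryPoly W G x x - 1

/-- The `ε`-Liénard vector field `x' = y - ε B̃_w(G₁; x)`, `y' = - B̃_w(E₁; x)` on the plane,
`E₁` being the graph with one vertex. -/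
def lienardField {V : Type*} [Fintype V] (W : Weights) (G₁ : SimpleGraph V) (ε : ℝ)
    (p : ℝ × ℝ) : ℝ × ℝ :=
  (p.2 - ε * reducedPoly W G₁ p.1, - reducedPoly W (⊥ : SimpleGraph (Fin 1)) p.1)

/-- `Γ` is a closed orbit (the trajectory of a nonconstant periodic solution) of `p' = F p`. -/
def IsClosedOrbit (F : ℝ × ℝ → ℝ × ℝ) (Γ : Set (ℝ × ℝ)) : Prop :=
  ∃ (γ : ℝ → ℝ × ℝ) (T : ℝ), IsIntegralCurve γ (fun _ => F) ∧ 0 < T ∧ Function.Periodic γ T ∧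
    (∃ t, γ t ≠ γ 0) ∧ Set.range γ = Γ

/-- A limit cycle: an isolated closed orbit, i.e. one that has a neighbourhood in which no other
closed orbit is contained. -/
def IsLimitCycle (F : ℝ × ℝ → ℝ × ℝ) (Γ : Set (ℝ × ℝ)) : Prop :=
  IsClosedOrbit F Γ ∧
    ∃ U : Set (ℝ × ℝ), IsOpen U ∧ Γ ⊆ U ∧ ∀ Γ', IsClosedOrbit F Γ' → Γ' ⊆ U → Γ' = Γ

/-- The circle of radius `r` about the origin. -/
def originCircle (r : ℝ) : Set (ℝ × ℝ) := {p | p.1 ^ 2 + p.2 ^ 2 = r ^ 2}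

/-- `G₁` is associated to `N` limit cycles asymptotic to the circles of radii `r 0, …, r (N - 1)`:
for all sufficiently small `ε ≠ 0` the `ε`-Liénard system has `N` distinct limit cycles
`Γ 0 ε, …, Γ (N - 1) ε`, and `Γ j ε` tends to the circle of radius `r j` about the origin, in the
Hausdorff sense, as `ε → 0`. (Hausdorff distances are taken for the maximum metric of `ℝ × ℝ`,
which has the same convergent families as the Euclidean one.) -/
def IsAssociated {V : Type*} [Fintype V] (W : Weights) (G₁ : SimpleGraph V) {N : ℕ}
    (r : Fin N → ℝ) : Prop :=
  ∃ Γ : Fin N → ℝ → Set (ℝ × ℝ),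
    (∀ᶠ ε in 𝓝[≠] (0 : ℝ),
      (∀ j, IsLimitCycle (lienardField W G₁ ε) (Γ j ε)) ∧ Function.Injective fun j => Γ j ε) ∧
    ∀ j, Tendsto (fun ε => Metric.hausdorffEDist (Γ j ε) (originCircle (r j))) (𝓝[≠] 0) (𝓝 0)

end BoundaryLienard

end

namespace BoundaryLienard

/-! In the coordinates `s = log R` and the clockwise angle `φ`, closed orbits near a circle about
the origin are, for small `ε`, the graphs of `2π`-periodic solutions of a scalar equation `ds/dφ = ε
D₀(s, φ, ε)` (`exists_periodicSol_of_closedOrbit`). Averaging `D₀` over `φ` at `ε = 0` leaves only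
the odd part of the damping polynomial. Up to sign the average is a polynomial `p` in `u = R ^ 2` of
degree at most `N`, whose coefficients are the odd-degree coefficients of the damping times positive
cosine means.

A cycle tending to the circle of radius `r` forces `p (r ^ 2) = 0`. The radii may coincide, so
multiplicities are needed: `k` distinct cycles tending to one circle make `p` vanish to order `k`.
This is shown for `k ≤ 4` (`integral_zero` to `integral_three`): the logarithm of the gap between
two solutions has derivative `ε` times a slope of `D₀`, so integrals of slopes over a period vanish,
and combinations of slopes are divided differences of `D₀`, which converge to its derivatives.

If `p` has no positive zero of multiplicity four, the squared radii are therefore `N` positive zeros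
counted with multiplicity. Hence `p` is a nonzero constant times the product of the `u - r j ^ 2`,
and its coefficients strictly alternate in sign (`mul_succ_neg_of_roots`).

Neither graph permits this. Let `K` be the default coefficient. For the complete graph the first two
odd-degree coefficients are `K` and `3 K`. For the empty graph they are `C(m, 2i+1) + 2 i K`: the
first is positive, so the second must be negative, and then `K` is so negative that the last two are
both negative. Quadruple zeros are excluded in the manner of Descartes' rule: unimodality of `C(m,
2i+1) / (2i)` allows at most three sign changes for the empty graph, and the complete graph has at
most one. If all coefficients vanish for the complete graph, the system is the linear centre, whose
closed orbits are not isolated. -/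

/-! ### Divided differences and Rolle's theorem -/

/-- Rolle's theorem for a function with three zeros. -/
theorem exists_second_deriv_eq_zero {f f₁ f₂ : ℝ → ℝ} {a b c : ℝ} (hab : a < b) (hbc : b < c)
    (h₁ : ∀ x ∈ Set.Icc a c, HasDerivAt f (f₁ x) x)
    (h₂ : ∀ x ∈ Set.Icc a c, HasDerivAt f₁ (f₂ x) x)
    (ha : f a = 0) (hb : f b = 0) (hc : f c = 0) : ∃ ξ ∈ Set.Ioo a c, f₂ ξ = 0 := by
  obtain ⟨x, hx, hx0⟩ := exists_hasDerivAt_eq_zero hab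
    (fun t ht => (h₁ t ⟨ht.1, ht.2.trans hbc.le⟩).continuousAt.continuousWithinAt)
    (ha.trans hb.symm) (fun t ht => h₁ t ⟨ht.1.le, ht.2.le.trans hbc.le⟩)
  obtain ⟨y, hy, hy0⟩ := exists_hasDerivAt_eq_zero hbc
    (fun t ht => (h₁ t ⟨hab.le.trans ht.1, ht.2⟩).continuousAt.continuousWithinAt)
    (hb.trans hc.symm) (fun t ht => h₁ t ⟨hab.le.trans ht.1.le, ht.2.le⟩)
  have hxy : x < y := hx.2.trans hy.1
  obtain ⟨z, hz, hz0⟩ := exists_hasDerivAt_eq_zero hxy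
    (fun t ht => (h₂ t ⟨hx.1.le.trans ht.1, ht.2.trans hy.2.le⟩).continuousAt.continuousWithinAt)
    (hx0.trans hy0.symm) (fun t ht => h₂ t ⟨hx.1.le.trans ht.1.le, ht.2.le.trans hy.2.le⟩)
  exact ⟨z, ⟨hx.1.trans hz.1, hz.2.trans hy.2⟩, hz0⟩

/-- Rolle's theorem for a function with four zeros. -/
theorem exists_third_deriv_eq_zero {f f₁ f₂ f₃ : ℝ → ℝ} {a b c d : ℝ} (hab : a < b) (hbc : b < c)
    (hcd : c < d) (h₁ : ∀ x ∈ Set.Icc a d, HasDerivAt f (f₁ x) x)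
    (h₂ : ∀ x ∈ Set.Icc a d, HasDerivAt f₁ (f₂ x) x)
    (h₃ : ∀ x ∈ Set.Icc a d, HasDerivAt f₂ (f₃ x) x)
    (ha : f a = 0) (hb : f b = 0) (hc : f c = 0) (hd : f d = 0) :
    ∃ ξ ∈ Set.Ioo a d, f₃ ξ = 0 := by
  have key : ∀ p q, a ≤ p → p < q → q ≤ d → f p = 0 → f q = 0 → ∃ x ∈ Set.Ioo p q, f₁ x = 0 := by
    intro p q hap hpq hqd hp hq
    exact exists_hasDerivAt_eq_zero hpq
      (fun t ht => (h₁ t ⟨hap.trans ht.1, ht.2.trans hqd⟩).continuousAt.continuousWithinAt)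
      (hp.trans hq.symm) (fun t ht => h₁ t ⟨hap.trans ht.1.le, ht.2.le.trans hqd⟩)
  obtain ⟨x, hx, hx0⟩ := key a b le_rfl hab (hbc.trans hcd).le ha hb
  obtain ⟨y, hy, hy0⟩ := key b c hab.le hbc hcd.le hb hc
  obtain ⟨z, hz, hz0⟩ := key c d (hab.trans hbc).le hcd le_rfl hc hd
  have hsub : ∀ t ∈ Set.Icc x z, t ∈ Set.Icc a d := fun t ht =>
    ⟨hx.1.le.trans ht.1, ht.2.trans hz.2.le⟩
  obtain ⟨ξ, hξ, hξ0⟩ := exists_second_deriv_eq_zero (hx.2.trans hy.1) (hy.2.trans hz.1)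
    (fun t ht => h₂ t (hsub t ht)) (fun t ht => h₃ t (hsub t ht)) hx0 hy0 hz0
  exact ⟨ξ, ⟨hx.1.trans hξ.1, hξ.2.trans hz.2⟩, hξ0⟩

/-- Mean value theorem for divided differences of order two. -/
theorem exists_slope_sub_slope {f f₁ f₂ : ℝ → ℝ} {a b c : ℝ} (hab : a < b) (hbc : b < c)
    (h₁ : ∀ x ∈ Set.Icc a c, HasDerivAt f (f₁ x) x)
    (h₂ : ∀ x ∈ Set.Icc a c, HasDerivAt f₁ (f₂ x) x) :
    ∃ ξ ∈ Set.Ioo a c, (f c - f a) / (c - a) - (f b - f a) / (b - a) = f₂ ξ / 2 * (c - b) := by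
  set A := (f b - f a) / (b - a) with hA
  set B := ((f c - f a) / (c - a) - A) / (c - b) with hB
  have hab' : b - a ≠ 0 := by linarith
  have hbc' : c - b ≠ 0 := by linarith
  have hac' : c - a ≠ 0 := by linarith
  -- Rolle is applied to `f` minus its quadratic Newton interpolant at `a`, `b`, `c`; `B` is the
  -- second divided difference.
  obtain ⟨ξ, hξ, h0⟩ := exists_second_deriv_eq_zero
    (f := fun x => f x - (f a + A * (x - a) + B * ((x - a) * (x - b))))
    (f₁ := fun x => f₁ x - (A + B * ((x - b) + (x - a)))) (f₂ := fun x => f₂ x - B * 2) hab hbc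
    (fun x hx => by
      refine (h₁ x hx).sub ?_
      have e1 : HasDerivAt (fun x : ℝ => x - a) 1 x := (hasDerivAt_id x).sub_const a
      have e2 : HasDerivAt (fun x : ℝ => x - b) 1 x := (hasDerivAt_id x).sub_const b
      exact (((e1.const_mul A).const_add (f a)).add ((e1.mul e2).const_mul B)).congr_deriv (by
        ring))
    (fun x hx => by
      refine (h₂ x hx).sub ?_
      have e1 : HasDerivAt (fun x : ℝ => x - a) 1 x := (hasDerivAt_id x).sub_const a
      have e2 : HasDerivAt (fun x : ℝ => x - b) 1 x := (hasDerivAt_id x).sub_const b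
      exact (((e2.add e1).const_mul B).const_add A).congr_deriv (by
        ring))
    (by ring) (by simp only [hA]; field_simp; ring) (by simp only [hB]; field_simp; ring)
  refine ⟨ξ, hξ, ?_⟩
  have : f₂ ξ / 2 = B := by linarith
  rw [this, hB]
  field_simp

/-- Mean value theorem for divided differences of order three. -/
theorem exists_slope_cross {f f₁ f₂ f₃ : ℝ → ℝ} {a b c d : ℝ} (hab : a < b) (hbc : b < c)
    (hcd : c < d) (h₁ : ∀ x ∈ Set.Icc a d, HasDerivAt f (f₁ x) x)
    (h₂ : ∀ x ∈ Set.Icc a d, HasDerivAt f₁ (f₂ x) x)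
    (h₃ : ∀ x ∈ Set.Icc a d, HasDerivAt f₂ (f₃ x) x) :
    ∃ ξ ∈ Set.Ioo a d, (f d - f b) / (d - b) + (f c - f a) / (c - a) - (f c - f b) / (c - b)
      - (f d - f a) / (d - a) = f₃ ξ / 6 * ((b - a) * (d - c)) := by
  have hab' : b - a ≠ 0 := by linarith
  have hbc' : c - b ≠ 0 := by linarith
  have hac' : c - a ≠ 0 := by linarith
  have hcd' : d - c ≠ 0 := by linarith
  have hbd' : d - b ≠ 0 := by linarith
  have had' : d - a ≠ 0 := by linarith
  set A := (f b - f a) / (b - a) with hA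
  set B := ((f c - f a) / (c - a) - A) / (c - b) with hB
  set C := ((f d - f b) / (d - b) + (f c - f a) / (c - a) - (f c - f b) / (c - b)
      - (f d - f a) / (d - a)) / ((b - a) * (d - c)) with hC
  -- Same argument with the cubic Newton interpolant; the combination of four slopes, divided by `(b
  -- - a) * (d - c)`, is the third divided difference `C`.
  obtain ⟨ξ, hξ, h0⟩ := exists_third_deriv_eq_zero
    (f := fun x => f x - (f a + A * (x - a) + B * ((x - a) * (x - b))
      + C * ((x - a) * (x - b) * (x - c))))
    (f₁ := fun x => f₁ x - (A + B * ((x - b) + (x - a))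
      + C * (((x - b) + (x - a)) * (x - c) + (x - a) * (x - b))))
    (f₂ := fun x => f₂ x - (B * 2 + C * (2 * (x - c) + 2 * ((x - b) + (x - a)))))
    (f₃ := fun x => f₃ x - C * 6) hab hbc hcd
    (fun x hx => by
      refine (h₁ x hx).sub ?_
      have e1 : HasDerivAt (fun x : ℝ => x - a) 1 x := (hasDerivAt_id x).sub_const a
      have e2 : HasDerivAt (fun x : ℝ => x - b) 1 x := (hasDerivAt_id x).sub_const b
      have e3 : HasDerivAt (fun x : ℝ => x - c) 1 x := (hasDerivAt_id x).sub_const c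
      exact ((((e1.const_mul A).const_add (f a)).add ((e1.mul e2).const_mul B)).add
        (((e1.mul e2).mul e3).const_mul C)).congr_deriv (by
        simp only [Pi.mul_apply]; ring))
    (fun x hx => by
      refine (h₂ x hx).sub ?_
      have e1 : HasDerivAt (fun x : ℝ => x - a) 1 x := (hasDerivAt_id x).sub_const a
      have e2 : HasDerivAt (fun x : ℝ => x - b) 1 x := (hasDerivAt_id x).sub_const b
      have e3 : HasDerivAt (fun x : ℝ => x - c) 1 x := (hasDerivAt_id x).sub_const c
      exact ((((e2.add e1).const_mul B).const_add A).add
        ((((e2.add e1).mul e3).add (e1.mul e2)).const_mul C)).congr_deriv (by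
        simp only [Pi.add_apply]; ring))
    (fun x hx => by
      refine (h₃ x hx).sub ?_
      have e1 : HasDerivAt (fun x : ℝ => x - a) 1 x := (hasDerivAt_id x).sub_const a
      have e2 : HasDerivAt (fun x : ℝ => x - b) 1 x := (hasDerivAt_id x).sub_const b
      have e3 : HasDerivAt (fun x : ℝ => x - c) 1 x := (hasDerivAt_id x).sub_const c
      exact ((((e3.const_mul 2).add ((e2.add e1).const_mul 2)).const_mul C).const_add
        (B * 2)).congr_deriv (by
        ring))
    (by ring) (by simp only [hA]; field_simp; ring) (by simp only [hB]; field_simp; ring)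
    (by simp only [hC, hB, hA]; field_simp; ring)
  refine ⟨ξ, hξ, ?_⟩
  have : f₃ ξ / 6 = C := by linarith
  rw [this, hC]
  field_simp

/-! ### Averaging for clusters of periodic solutions -/

/-- `D k` is the `k`-th derivative in the first variable of a function `D 0` of three variables,
near the points `(s₀, φ, 0)`. -/
structure IsDerivFamily (D : ℕ → ℝ × ℝ × ℝ → ℝ) (s₀ ε₀ : ℝ) : Prop where
  pos : 0 < ε₀
  hasDerivAt : ∀ k s φ ε, |s - s₀| ≤ 1 → |ε| ≤ ε₀ →
    HasDerivAt (fun s => D k (s, φ, ε)) (D (k + 1) (s, φ, ε)) s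
  continuousAt : ∀ k s φ ε, |s - s₀| ≤ 1 → |ε| ≤ ε₀ → ContinuousAt (D k) (s, φ, ε)

/-- `v` is a `2π`-periodic solution of `v' = ε D₀(v, φ, ε)`. -/
structure IsPeriodicSol (D : ℕ → ℝ × ℝ × ℝ → ℝ) (ε : ℝ) (v : ℝ → ℝ) : Prop where
  hasDerivAt : ∀ φ, HasDerivAt v (ε * D 0 (v φ, φ, ε)) φ
  periodic : Function.Periodic v (2 * Real.pi)

variable {D : ℕ → ℝ × ℝ × ℝ → ℝ} {s₀ ε₀ : ℝ}

theorem IsDerivFamily.exists_bound (h : IsDerivFamily D s₀ ε₀) (k : ℕ) (M : ℝ) :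
    ∃ C, 0 < C ∧ ∀ s φ ε, |s - s₀| ≤ 1 → |φ| ≤ M → |ε| ≤ ε₀ → |D k (s, φ, ε)| ≤ C := by
  have hK : IsCompact (Metric.closedBall s₀ 1 ×ˢ (Metric.closedBall (0 : ℝ) M ×ˢ
      Metric.closedBall (0 : ℝ) ε₀)) :=
    (isCompact_closedBall _ _).prod ((isCompact_closedBall _ _).prod (isCompact_closedBall _ _))
  have hc : ContinuousOn (D k) (Metric.closedBall s₀ 1 ×ˢ (Metric.closedBall (0 : ℝ) M ×ˢ
      Metric.closedBall (0 : ℝ) ε₀)) := by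
    rintro ⟨s, φ, ε⟩ ⟨hs, -, hε⟩
    simp only [Metric.mem_closedBall, Real.dist_eq, sub_zero] at hs hε
    exact (h.continuousAt k s φ ε hs hε).continuousWithinAt
  obtain ⟨C, hC⟩ := hK.exists_bound_of_continuousOn hc
  refine ⟨max C 1, lt_max_of_lt_right one_pos, fun s φ ε hs hφ hε => (hC (s, φ, ε) ?_).trans
    (le_max_left _ _)⟩
  simp [Metric.mem_closedBall, Real.dist_eq, hs, hφ, hε]

theorem abs_sub_le_of_mem_Icc {a b x s₀ δ : ℝ} (ha : |a - s₀| ≤ δ) (hb : |b - s₀| ≤ δ)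
    (hx : x ∈ Set.Icc a b) : |x - s₀| ≤ δ := by
  rw [abs_le] at *
  exact ⟨by linarith [hx.1], by linarith [hx.2]⟩

/-- Uniqueness of the solutions of `v' = ε D₀(v, φ, ε)`. -/
theorem IsDerivFamily.sol_unique (h : IsDerivFamily D s₀ ε₀) {ε : ℝ} (hε : |ε| ≤ ε₀)
    {v w : ℝ → ℝ} (hv : ∀ φ, HasDerivAt v (ε * D 0 (v φ, φ, ε)) φ)
    (hw : ∀ φ, HasDerivAt w (ε * D 0 (w φ, φ, ε)) φ) (hvs : ∀ φ, |v φ - s₀| ≤ 1)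
    (hws : ∀ φ, |w φ - s₀| ≤ 1) {φ₀ : ℝ} (h0 : v φ₀ = w φ₀) : v = w := by
  funext φ
  set M := |φ₀| + |φ| + 1 with hM
  obtain ⟨C, hC0, hC⟩ := h.exists_bound 1 M
  have hLip : ∀ t ∈ Set.Ioo (-M) M, LipschitzOnWith (Real.toNNReal (|ε| * C))
      ((fun t s => ε * D 0 (s, t, ε)) t) ((fun _ => Metric.closedBall s₀ 1) t) := by
    intro t ht
    refine Convex.lipschitzOnWith_of_nnnorm_hasDerivWithin_le (convex_closedBall _ _)
      (f' := fun s => ε * D 1 (s, t, ε)) (fun s hs => ?_) (fun s hs => ?_)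
    · rw [Metric.mem_closedBall, Real.dist_eq] at hs
      exact ((h.hasDerivAt 0 s t ε hs hε).const_mul ε).hasDerivWithinAt
    · rw [Metric.mem_closedBall, Real.dist_eq] at hs
      rw [← NNReal.coe_le_coe, Real.coe_toNNReal _ (by positivity), coe_nnnorm, Real.norm_eq_abs,
        abs_mul]
      exact mul_le_mul_of_nonneg_left (hC s t ε hs (abs_le.2 ⟨ht.1.le, ht.2.le⟩) hε)
        (abs_nonneg _)
  have hmem : ∀ t : ℝ, |t| < M → t ∈ Set.Ioo (-M) M := fun t ht => abs_lt.1 ht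
  refine ODE_solution_unique_of_mem_Ioo hLip (hmem φ₀ ?_) (fun t _ => ⟨hv t, ?_⟩)
    (fun t _ => ⟨hw t, ?_⟩) h0 (hmem φ ?_)
  · linarith [abs_nonneg φ]
  · simpa [Metric.mem_closedBall, Real.dist_eq] using hvs t
  · simpa [Metric.mem_closedBall, Real.dist_eq] using hws t
  · linarith [abs_nonneg φ₀]

/-- Two solutions of `v' = ε D₀(v, φ, ε)` that are ordered at one point are ordered everywhere. -/
theorem IsDerivFamily.sol_lt (h : IsDerivFamily D s₀ ε₀) {ε : ℝ} (hε : |ε| ≤ ε₀)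
    {v w : ℝ → ℝ} (hv : ∀ φ, HasDerivAt v (ε * D 0 (v φ, φ, ε)) φ)
    (hw : ∀ φ, HasDerivAt w (ε * D 0 (w φ, φ, ε)) φ) (hvs : ∀ φ, |v φ - s₀| ≤ 1)
    (hws : ∀ φ, |w φ - s₀| ≤ 1) {φ₀ : ℝ} (h0 : v φ₀ < w φ₀) (φ : ℝ) : v φ < w φ := by
  by_contra! hcon
  have hcv : Continuous v := continuous_iff_continuousAt.2 fun φ => (hv φ).continuousAt
  have hcw : Continuous w := continuous_iff_continuousAt.2 fun φ => (hw φ).continuousAt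
  obtain ⟨ψ, hψ⟩ := mem_range_of_exists_le_of_exists_ge (hcw.sub hcv) (c := 0)
    ⟨φ, sub_nonpos.2 hcon⟩ ⟨φ₀, (sub_pos.2 h0).le⟩
  have := h.sol_unique hε hv hw hvs hws (φ₀ := ψ) (sub_eq_zero.1 hψ).symm
  rw [this] at h0
  exact lt_irrefl _ h0

/-- Passage to the limit in the identities that a family of periodic solutions satisfies. -/
theorem IsDerivFamily.integral_eq_zero (h : IsDerivFamily D s₀ ε₀) (k : ℕ)
    (hJ : ∀ δ > 0, ∃ (ε : ℝ) (J W : ℝ → ℝ), |ε| ≤ δ ∧ Continuous J ∧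
      ∫ φ in (0)..(2 * Real.pi), J φ = 0 ∧ ∀ φ ∈ Set.Icc 0 (2 * Real.pi),
        0 < W φ ∧ |Real.log (W φ)| ≤ δ ∧ ∃ ξ, |ξ - s₀| ≤ δ ∧ J φ = D k (ξ, φ, ε) * W φ) :
    ∫ φ in (0)..(2 * Real.pi), D k (s₀, φ, 0) = 0 := by
  have hδ : ∀ n : ℕ, 0 < min ε₀ (1 / ((n : ℝ) + 1)) := fun n => lt_min h.pos (by positivity)
  choose ε J W hε hJc hJ0 hW using fun n : ℕ => hJ _ (hδ n)
  have hδ0 : Tendsto (fun n : ℕ => min ε₀ (1 / ((n : ℝ) + 1))) atTop (𝓝 0) :=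
    squeeze_zero (fun n => (hδ n).le) (fun n => min_le_right _ _)
      tendsto_one_div_add_atTop_nhds_zero_nat
  have hδ1 : ∀ n : ℕ, min ε₀ (1 / ((n : ℝ) + 1)) ≤ 1 := fun n =>
    (min_le_right _ _).trans ((div_le_one (by positivity)).2 (by linarith [n.cast_nonneg (α := ℝ)]))
  obtain ⟨C, hC0, hC⟩ := h.exists_bound k (2 * Real.pi)
  have hpi : (0 : ℝ) ≤ 2 * Real.pi := by positivity
  have hioc : Set.uIoc 0 (2 * Real.pi) ⊆ Set.Icc 0 (2 * Real.pi) := by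
    rw [Set.uIoc_of_le hpi]; exact Set.Ioc_subset_Icc_self
  have hε0 : Tendsto ε atTop (𝓝 0) := squeeze_zero_norm (fun n => by simpa using hε n) hδ0
  have hlim : Tendsto (fun n => ∫ φ in (0)..(2 * Real.pi), J n φ) atTop
      (𝓝 (∫ φ in (0)..(2 * Real.pi), D k (s₀, φ, 0))) := by
    -- The factor `W` is at most `exp 1` because `|log W| ≤ 1`, which gives the constant dominating
    -- function.
    refine intervalIntegral.tendsto_integral_filter_of_dominated_convergence
      (fun _ => C * Real.exp 1) (Eventually.of_forall fun n => (hJc n).aestronglyMeasurable)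
      (Eventually.of_forall fun n => Eventually.of_forall fun φ hφ => ?_)
      (by simp) (Eventually.of_forall fun φ hφ => ?_)
    · obtain ⟨hWpos, hWlog, ξ, hξ, hJξ⟩ := hW n φ (hioc hφ)
      rw [hJξ, norm_mul, Real.norm_eq_abs, Real.norm_eq_abs, abs_of_pos hWpos]
      refine mul_le_mul (hC ξ φ _ (hξ.trans (hδ1 n)) ?_ ((hε n).trans (min_le_left _ _))) ?_
        hWpos.le hC0.le
      · rw [abs_of_nonneg (hioc hφ).1]; exact (hioc hφ).2
      · rw [← Real.exp_log hWpos]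
        exact Real.exp_le_exp.2 ((le_abs_self _).trans (hWlog.trans (hδ1 n)))
    · choose hWpos hWlog ξ hξ hJξ using fun n => hW n φ (hioc hφ)
      have hξ0 : Tendsto ξ atTop (𝓝 s₀) := by
        rw [tendsto_iff_norm_sub_tendsto_zero]
        exact squeeze_zero (fun _ => norm_nonneg _) (fun n => hξ n) hδ0
      have hlog : Tendsto (fun n => Real.log (W n φ)) atTop (𝓝 0) :=
        squeeze_zero_norm hWlog hδ0
      have hW1 : Tendsto (fun n => W n φ) atTop (𝓝 1) := by
        have := (Real.continuous_exp.tendsto 0).comp hlog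
        rw [Real.exp_zero] at this
        exact this.congr fun n => Real.exp_log (hWpos n)
      have hDlim : Tendsto (fun n => D k (ξ n, φ, ε n)) atTop (𝓝 (D k (s₀, φ, 0))) :=
        (h.continuousAt k s₀ φ 0 (by simp) (by simpa using h.pos.le)).tendsto.comp
          (hξ0.prodMk_nhds (tendsto_const_nhds.prodMk_nhds hε0))
      simpa [hJξ] using hDlim.mul hW1
  simp only [hJ0] at hlim
  exact (tendsto_nhds_unique hlim tendsto_const_nhds)

/-- The slope of `D 0` between two solutions. -/
noncomputable def solSlope (D : ℕ → ℝ × ℝ × ℝ → ℝ) (ε : ℝ) (v w : ℝ → ℝ) (φ : ℝ) : ℝ :=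
  (D 0 (w φ, φ, ε) - D 0 (v φ, φ, ε)) / (w φ - v φ)

theorem IsPeriodicSol.continuous {ε : ℝ} {v : ℝ → ℝ} (hv : IsPeriodicSol D ε v) :
    Continuous v :=
  continuous_iff_continuousAt.2 fun φ => (hv.hasDerivAt φ).continuousAt

theorem IsDerivFamily.continuous_comp (h : IsDerivFamily D s₀ ε₀) {ε : ℝ} (hε : |ε| ≤ ε₀)
    {v : ℝ → ℝ} (hv : Continuous v) (hvs : ∀ φ, |v φ - s₀| ≤ 1) (k : ℕ) :
    Continuous fun φ => D k (v φ, φ, ε) :=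
  continuous_iff_continuousAt.2 fun φ =>
    ContinuousAt.comp (f := fun φ => (v φ, φ, ε)) (h.continuousAt k (v φ) φ ε (hvs φ) hε)
      (hv.continuousAt.prodMk (continuousAt_id.prodMk continuousAt_const))

theorem IsDerivFamily.continuous_solSlope (h : IsDerivFamily D s₀ ε₀) {ε : ℝ} (hε : |ε| ≤ ε₀)
    {v w : ℝ → ℝ} (hv : IsPeriodicSol D ε v) (hw : IsPeriodicSol D ε w)
    (hvs : ∀ φ, |v φ - s₀| ≤ 1) (hws : ∀ φ, |w φ - s₀| ≤ 1) (hlt : ∀ φ, v φ < w φ) :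
    Continuous (solSlope D ε v w) :=
  ((h.continuous_comp hε hw.continuous hws 0).sub (h.continuous_comp hε hv.continuous hvs 0)).div
    (hw.continuous.sub hv.continuous) fun φ => (sub_pos.2 (hlt φ)).ne'

theorem IsPeriodicSol.hasDerivAt_log {ε : ℝ} {v w : ℝ → ℝ} (hv : IsPeriodicSol D ε v)
    (hw : IsPeriodicSol D ε w) (hlt : ∀ φ, v φ < w φ) (φ : ℝ) :
    HasDerivAt (fun φ => Real.log (w φ - v φ)) (ε * solSlope D ε v w φ) φ := by
  refine (((hw.hasDerivAt φ).sub (hv.hasDerivAt φ)).log (sub_pos.2 (hlt φ)).ne').congr_deriv ?_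
  rw [solSlope, Pi.sub_apply]
  ring

/-- The distance between two solutions is almost constant. -/
theorem IsDerivFamily.abs_log_ratio_le (h : IsDerivFamily D s₀ ε₀) {ε C : ℝ} (hε : |ε| ≤ ε₀)
    (hC : ∀ s φ ε, |s - s₀| ≤ 1 → |φ| ≤ 2 * Real.pi → |ε| ≤ ε₀ → |D 1 (s, φ, ε)| ≤ C)
    {v w : ℝ → ℝ} (hv : IsPeriodicSol D ε v) (hw : IsPeriodicSol D ε w)
    (hvs : ∀ φ, |v φ - s₀| ≤ 1) (hws : ∀ φ, |w φ - s₀| ≤ 1) (hlt : ∀ φ, v φ < w φ)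
    {φ : ℝ} (hφ : φ ∈ Set.Icc 0 (2 * Real.pi)) :
    |Real.log ((w φ - v φ) / (w 0 - v 0))| ≤ |ε| * C * (2 * Real.pi) := by
  have hC0 : 0 ≤ C := (abs_nonneg _).trans (hC s₀ 0 0 (by simp) (by simp; positivity)
    (by simpa using h.pos.le))
  rw [Real.log_div (sub_pos.2 (hlt φ)).ne' (sub_pos.2 (hlt 0)).ne']
  have := (convex_Icc 0 (2 * Real.pi)).norm_image_sub_le_of_norm_hasDerivWithin_le
    (f := fun φ => Real.log (w φ - v φ)) (f' := fun φ => ε * solSlope D ε v w φ) (C := |ε| * C)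
    (fun ψ _ => (hv.hasDerivAt_log hw hlt ψ).hasDerivWithinAt) (fun ψ hψ => ?_)
    (Set.left_mem_Icc.2 (by positivity)) hφ
  · refine (this : |_| ≤ _).trans (mul_le_mul_of_nonneg_left ?_ (by positivity))
    rw [sub_zero, Real.norm_eq_abs, abs_of_nonneg hφ.1]
    exact hφ.2
  · rw [norm_mul, Real.norm_eq_abs]
    refine mul_le_mul_of_nonneg_left ?_ (abs_nonneg _)
    have hder : ∀ x ∈ Set.Icc (v ψ) (w ψ),
        HasDerivAt (fun s => D 0 (s, ψ, ε)) (D 1 (x, ψ, ε)) x := fun x hx =>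
      h.hasDerivAt 0 x ψ ε (abs_sub_le_of_mem_Icc (hvs ψ) (hws ψ) hx) hε
    obtain ⟨ξ, hξ, hs⟩ := exists_hasDerivAt_eq_slope (fun s => D 0 (s, ψ, ε))
      (fun s => D 1 (s, ψ, ε)) (hlt ψ)
      (fun x hx => (hder x hx).continuousAt.continuousWithinAt)
      (fun x hx => hder x (Set.Ioo_subset_Icc_self hx))
    rw [solSlope, Real.norm_eq_abs, ← hs]
    exact hC _ _ _ (abs_sub_le_of_mem_Icc (hvs ψ) (hws ψ) (Set.Ioo_subset_Icc_self hξ))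
      (by rw [abs_of_nonneg hψ.1]; exact hψ.2) hε

/-- For arbitrarily small `ε ≠ 0` there are `n` ordered periodic solutions close to `s₀`. -/
def HasSolClusters (D : ℕ → ℝ × ℝ × ℝ → ℝ) (s₀ : ℝ) (n : ℕ) : Prop :=
  ∀ δ > 0, ∃ ε : ℝ, ε ≠ 0 ∧ |ε| ≤ δ ∧ ∃ v : Fin n → ℝ → ℝ, (∀ i, IsPeriodicSol D ε (v i)) ∧
    (∀ i φ, |v i φ - s₀| ≤ δ) ∧ ∀ φ, StrictMono fun i => v i φ

/-- Source of all exact identities: `H` will be a solution or a combination of logarithms of gaps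
between solutions. Dividing out `ε` leaves a relation that survives the limit `ε → 0`. -/
theorem integral_eq_zero_of_periodic {H J : ℝ → ℝ} {ε : ℝ} (hε : ε ≠ 0)
    (hH : Function.Periodic H (2 * Real.pi)) (hd : ∀ φ, HasDerivAt H (ε * J φ) φ)
    (hJ : Continuous J) : ∫ φ in (0)..(2 * Real.pi), J φ = 0 := by
  have := intervalIntegral.integral_eq_sub_of_hasDerivAt (fun φ _ => hd φ)
    ((continuous_const.mul hJ).intervalIntegrable 0 (2 * Real.pi))
  rw [intervalIntegral.integral_const_mul, hH.eq, sub_self] at this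
  exact (mul_eq_zero.1 this).resolve_left hε

theorem IsDerivFamily.integral_zero (h : IsDerivFamily D s₀ ε₀) (hv : HasSolClusters D s₀ 1) :
    ∫ φ in (0)..(2 * Real.pi), D 0 (s₀, φ, 0) = 0 := by
  refine h.integral_eq_zero 0 fun δ hδ => ?_
  obtain ⟨ε, hε0, hε, v, hsol, hvδ, -⟩ := hv (min δ (min 1 ε₀))
    (lt_min hδ (lt_min one_pos h.pos))
  have hε₁ : |ε| ≤ ε₀ := hε.trans ((min_le_right _ _).trans (min_le_right _ _))
  have hv1 : ∀ i φ, |v i φ - s₀| ≤ 1 := fun i φ =>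
    (hvδ i φ).trans ((min_le_right _ _).trans (min_le_left _ _))
  have hc := h.continuous_comp hε₁ (hsol 0).continuous (hv1 0) 0
  exact ⟨ε, fun φ => D 0 (v 0 φ, φ, ε), fun _ => 1, hε.trans (min_le_left _ _), hc,
    integral_eq_zero_of_periodic hε0 (hsol 0).periodic (hsol 0).hasDerivAt hc,
    fun φ _ => ⟨one_pos, by simpa using hδ.le, v 0 φ, (hvδ 0 φ).trans (min_le_left _ _), by simp⟩⟩

/-- Ordered solutions, with all the smallness that the limit arguments need. -/
theorem IsDerivFamily.exists_sols (h : IsDerivFamily D s₀ ε₀) {n : ℕ}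
    (hv : HasSolClusters D s₀ n) {δ : ℝ} (hδ : 0 < δ) :
    ∃ ε : ℝ, ε ≠ 0 ∧ |ε| ≤ δ ∧ |ε| ≤ ε₀ ∧ ∃ v : Fin n → ℝ → ℝ,
      (∀ i, IsPeriodicSol D ε (v i)) ∧ (∀ i φ, |v i φ - s₀| ≤ δ) ∧ (∀ i φ, |v i φ - s₀| ≤ 1) ∧
      (∀ i j, i < j → ∀ φ, v i φ < v j φ) ∧
      (∀ i j, i < j → ∀ φ ∈ Set.Icc 0 (2 * Real.pi),
        |Real.log ((v j φ - v i φ) / (v j 0 - v i 0))| ≤ δ) ∧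
      ∀ k i φ, ∀ x ∈ Set.Icc (v i φ) (v k φ), |x - s₀| ≤ δ ∧
        ∀ l, HasDerivAt (fun s => D l (s, φ, ε)) (D (l + 1) (x, φ, ε)) x := by
  obtain ⟨C, hC0, hC⟩ := h.exists_bound 1 (2 * Real.pi)
  have hpos : 0 < C * (2 * Real.pi) := by positivity
  -- The bound `δ / (C * (2π))` on `ε` turns the estimate `|ε| * C * 2π` for the logarithmic gap
  -- ratios into `δ`.
  obtain ⟨ε, hε0, hε, v, hsol, hvδ, hmono⟩ := hv (min (min δ (δ / (C * (2 * Real.pi)))) (min 1 ε₀))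
    (lt_min (lt_min hδ (by positivity)) (lt_min one_pos h.pos))
  have hε₁ : |ε| ≤ ε₀ := hε.trans ((min_le_right _ _).trans (min_le_right _ _))
  have hv1 : ∀ i φ, |v i φ - s₀| ≤ 1 := fun i φ =>
    (hvδ i φ).trans ((min_le_right _ _).trans (min_le_left _ _))
  have hv2 : ∀ i φ, |v i φ - s₀| ≤ δ := fun i φ =>
    (hvδ i φ).trans ((min_le_left _ _).trans (min_le_left _ _))
  refine ⟨ε, hε0, hε.trans ((min_le_left _ _).trans (min_le_left _ _)), hε₁, v, hsol, hv2, hv1,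
    fun i j hij φ => hmono φ hij, fun i j hij φ hφ => ?_, fun k i φ x hx =>
      ⟨abs_sub_le_of_mem_Icc (hv2 i φ) (hv2 k φ) hx, fun l =>
        h.hasDerivAt l x φ ε (abs_sub_le_of_mem_Icc (hv1 i φ) (hv1 k φ) hx) hε₁⟩⟩
  refine (h.abs_log_ratio_le hε₁ hC (hsol i) (hsol j) (hv1 i) (hv1 j)
    (fun φ => hmono φ hij) hφ).trans ?_
  rw [mul_assoc]
  exact (le_div_iff₀ hpos).1 (hε.trans ((min_le_left _ _).trans (min_le_right _ _)))

theorem IsPeriodicSol.periodic_log {ε : ℝ} {v w : ℝ → ℝ} (hv : IsPeriodicSol D ε v)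
    (hw : IsPeriodicSol D ε w) :
    Function.Periodic (fun φ => Real.log (w φ - v φ)) (2 * Real.pi) := fun φ => by
  simp only [hv.periodic φ, hw.periodic φ]

/-- The logarithm of the gap is periodic, so the slope of `D 0` between the two solutions has
integral zero; by the mean value theorem this slope is a value of `D 1` near `s₀`. -/
theorem IsDerivFamily.integral_one (h : IsDerivFamily D s₀ ε₀) (hv : HasSolClusters D s₀ 2) :
    ∫ φ in (0)..(2 * Real.pi), D 1 (s₀, φ, 0) = 0 := by
  refine h.integral_eq_zero 1 fun δ hδ => ?_
  obtain ⟨ε, hε0, hε, hε₁, v, hsol, hvδ, hv1, hlt, hlog, hder⟩ := h.exists_sols hv hδ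
  have h01 := hlt 0 1 (by decide)
  have hc := h.continuous_solSlope hε₁ (hsol 0) (hsol 1) (hv1 0) (hv1 1) h01
  refine ⟨ε, solSlope D ε (v 0) (v 1), fun _ => 1, hε, hc,
    integral_eq_zero_of_periodic hε0 ((hsol 0).periodic_log (hsol 1))
      ((hsol 0).hasDerivAt_log (hsol 1) h01) hc, fun φ _ => ⟨one_pos, by simpa using hδ.le, ?_⟩⟩
  obtain ⟨ξ, hξ, hs⟩ := exists_hasDerivAt_eq_slope (fun s => D 0 (s, φ, ε))
    (fun s => D 1 (s, φ, ε)) (h01 φ)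
    (fun x hx => ((hder 1 0 φ x hx).2 0).continuousAt.continuousWithinAt)
    (fun x hx => (hder 1 0 φ x (Set.Ioo_subset_Icc_self hx)).2 0)
  exact ⟨ξ, (hder 1 0 φ ξ (Set.Ioo_subset_Icc_self hξ)).1, by rw [mul_one, hs, solSlope]⟩

/-- The difference of two slopes with a common endpoint is half a value of `D 2` times the gap
between the other endpoints. That gap tends to zero, but relative to its value at angle `0` it tends
to `1`, so the quotient has a limit. -/
theorem IsDerivFamily.integral_two (h : IsDerivFamily D s₀ ε₀) (hv : HasSolClusters D s₀ 3) :
    ∫ φ in (0)..(2 * Real.pi), D 2 (s₀, φ, 0) = 0 := by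
  refine h.integral_eq_zero 2 fun δ hδ => ?_
  obtain ⟨ε, hε0, hε, hε₁, v, hsol, hvδ, hv1, hlt, hlog, hder⟩ := h.exists_sols hv hδ
  have h01 := hlt 0 1 (by decide)
  have h02 := hlt 0 2 (by decide)
  have h12 := hlt 1 2 (by decide)
  have hc01 := h.continuous_solSlope hε₁ (hsol 0) (hsol 1) (hv1 0) (hv1 1) h01
  have hc02 := h.continuous_solSlope hε₁ (hsol 0) (hsol 2) (hv1 0) (hv1 2) h02
  have hc := hc02.sub hc01
  have hint := integral_eq_zero_of_periodic hε0
    (((hsol 0).periodic_log (hsol 2)).sub ((hsol 0).periodic_log (hsol 1)))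
    (fun φ => (((hsol 0).hasDerivAt_log (hsol 2) h02 φ).sub
      ((hsol 0).hasDerivAt_log (hsol 1) h01 φ)).congr_deriv (mul_sub _ _ _).symm) hc
  refine ⟨ε, fun φ => 2 / (v 2 0 - v 1 0) *
    (solSlope D ε (v 0) (v 2) φ - solSlope D ε (v 0) (v 1) φ),
    fun φ => (v 2 φ - v 1 φ) / (v 2 0 - v 1 0), hε, continuous_const.mul hc, ?_,
    fun φ hφ => ⟨div_pos (sub_pos.2 (h12 φ)) (sub_pos.2 (h12 0)), hlog 1 2 (by decide) φ hφ, ?_⟩⟩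
  · rw [intervalIntegral.integral_const_mul, hint, mul_zero]
  obtain ⟨ξ, hξ, hs⟩ := exists_slope_sub_slope (f := fun s => D 0 (s, φ, ε))
    (f₁ := fun s => D 1 (s, φ, ε)) (f₂ := fun s => D 2 (s, φ, ε)) (h01 φ) (h12 φ)
    (fun x hx => (hder 2 0 φ x hx).2 0) (fun x hx => (hder 2 0 φ x hx).2 1)
  refine ⟨ξ, (hder 2 0 φ ξ (Set.Ioo_subset_Icc_self hξ)).1, ?_⟩
  simp only [solSlope, hs]
  have := sub_pos.2 (h12 0)
  field_simp

/-- The logarithm of the cross-ratio of four solutions plays the role of the logarithmic gap: its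
derivative involves a third divided difference times the product of the two outer gaps. -/
theorem IsDerivFamily.integral_three (h : IsDerivFamily D s₀ ε₀) (hv : HasSolClusters D s₀ 4) :
    ∫ φ in (0)..(2 * Real.pi), D 3 (s₀, φ, 0) = 0 := by
  refine h.integral_eq_zero 3 fun δ hδ => ?_
  -- Half of `δ`, because the weight is a product of two gap ratios and their logarithms add.
  obtain ⟨ε, hε0, hε, hε₁, v, hsol, hvδ, hv1, hlt, hlog, hder⟩ := h.exists_sols hv (half_pos hδ)
  have h01 := hlt 0 1 (by decide)
  have h02 := hlt 0 2 (by decide)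
  have h03 := hlt 0 3 (by decide)
  have h12 := hlt 1 2 (by decide)
  have h13 := hlt 1 3 (by decide)
  have h23 := hlt 2 3 (by decide)
  have hc12 := h.continuous_solSlope hε₁ (hsol 1) (hsol 2) (hv1 1) (hv1 2) h12
  have hc13 := h.continuous_solSlope hε₁ (hsol 1) (hsol 3) (hv1 1) (hv1 3) h13
  have hc02 := h.continuous_solSlope hε₁ (hsol 0) (hsol 2) (hv1 0) (hv1 2) h02
  have hc03 := h.continuous_solSlope hε₁ (hsol 0) (hsol 3) (hv1 0) (hv1 3) h03
  have hc := ((hc13.add hc02).sub hc12).sub hc03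
  have hint := integral_eq_zero_of_periodic hε0
    (((((hsol 1).periodic_log (hsol 3)).add ((hsol 0).periodic_log (hsol 2))).sub
      ((hsol 1).periodic_log (hsol 2))).sub ((hsol 0).periodic_log (hsol 3)))
    (fun φ => (((((hsol 1).hasDerivAt_log (hsol 3) h13 φ).add
      ((hsol 0).hasDerivAt_log (hsol 2) h02 φ)).sub
      ((hsol 1).hasDerivAt_log (hsol 2) h12 φ)).sub
      ((hsol 0).hasDerivAt_log (hsol 3) h03 φ)).congr_deriv (g' := ε *
        (solSlope D ε (v 1) (v 3) φ + solSlope D ε (v 0) (v 2) φ - solSlope D ε (v 1) (v 2) φ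
          - solSlope D ε (v 0) (v 3) φ)) (by ring)) hc
  refine ⟨ε, fun φ => 6 / ((v 1 0 - v 0 0) * (v 3 0 - v 2 0)) *
    (solSlope D ε (v 1) (v 3) φ + solSlope D ε (v 0) (v 2) φ - solSlope D ε (v 1) (v 2) φ
      - solSlope D ε (v 0) (v 3) φ),
    fun φ => (v 1 φ - v 0 φ) / (v 1 0 - v 0 0) * ((v 3 φ - v 2 φ) / (v 3 0 - v 2 0)),
    hε.trans (half_le_self hδ.le), continuous_const.mul hc, ?_, fun φ hφ => ?_⟩
  · rw [intervalIntegral.integral_const_mul, hint, mul_zero]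
  have hp1 := div_pos (sub_pos.2 (h01 φ)) (sub_pos.2 (h01 0))
  have hp2 := div_pos (sub_pos.2 (h23 φ)) (sub_pos.2 (h23 0))
  refine ⟨mul_pos hp1 hp2, ?_, ?_⟩
  · rw [Real.log_mul hp1.ne' hp2.ne']
    refine (abs_add_le _ _).trans ?_
    linarith [hlog 0 1 (by decide) φ hφ, hlog 2 3 (by decide) φ hφ]
  obtain ⟨ξ, hξ, hs⟩ := exists_slope_cross (f := fun s => D 0 (s, φ, ε))
    (f₁ := fun s => D 1 (s, φ, ε)) (f₂ := fun s => D 2 (s, φ, ε)) (f₃ := fun s => D 3 (s, φ, ε))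
    (h01 φ) (h12 φ) (h23 φ) (fun x hx => (hder 3 0 φ x hx).2 0)
    (fun x hx => (hder 3 0 φ x hx).2 1) (fun x hx => (hder 3 0 φ x hx).2 2)
  refine ⟨ξ, ((hder 3 0 φ ξ (Set.Ioo_subset_Icc_self hξ)).1).trans (half_le_self hδ.le), ?_⟩
  simp only [solSlope, hs]
  have := sub_pos.2 (h01 0)
  have := sub_pos.2 (h23 0)
  field_simp

/-! ### The polar equation and its averages -/

/-- `F(x) / R` for `F(x) = ∑ e < m, c e * x ^ (e + 1)`, `R = exp s` and `x = R cos φ`. -/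
noncomputable def radialSum (c : ℕ → ℝ) (m : ℕ) (s φ : ℝ) : ℝ :=
  ∑ e ∈ Finset.range m, c e * Real.exp (e * s) * Real.cos φ ^ (e + 1)

/-- In terms of `s = log R` and the clockwise angle `φ`, the orbits of the system
`x' = y - ε F(x)`, `y' = -x` are given by `ds/dφ = ε * polarField c m (s, φ, ε)`. -/
noncomputable def polarField (c : ℕ → ℝ) (m : ℕ) (p : ℝ × ℝ × ℝ) : ℝ :=
  -(Real.cos p.2.1 * radialSum c m p.1 p.2.1) /
    (1 + p.2.2 * (Real.sin p.2.1 * radialSum c m p.1 p.2.1))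

/-- The derivatives of `polarField` in the radial variable. -/
noncomputable def polarDeriv (c : ℕ → ℝ) (m : ℕ) : ℕ → ℝ × ℝ × ℝ → ℝ
  | 0 => polarField c m
  | k + 1 => fun p => fderiv ℝ (polarDeriv c m k) p (1, 0, 0)

/-- The domain of `polarField`. -/
def polarDomain (c : ℕ → ℝ) (m : ℕ) : Set (ℝ × ℝ × ℝ) :=
  {p | 1 + p.2.2 * (Real.sin p.2.1 * radialSum c m p.1 p.2.1) ≠ 0}

theorem contDiff_radialSum (c : ℕ → ℝ) (m : ℕ) {n : WithTop ℕ∞} :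
    ContDiff ℝ n fun p : ℝ × ℝ × ℝ => radialSum c m p.1 p.2.1 := by
  unfold radialSum
  fun_prop

theorem isOpen_polarDomain (c : ℕ → ℝ) (m : ℕ) : IsOpen (polarDomain c m) := by
  refine isOpen_ne_fun ?_ continuous_const
  have := (contDiff_radialSum c m (n := 0)).continuous
  fun_prop

theorem contDiffOn_polarDeriv (c : ℕ → ℝ) (m k : ℕ) :
    ContDiffOn ℝ (⊤ : ℕ∞) (polarDeriv c m k) (polarDomain c m) := by
  induction k with
  | zero =>
    have := contDiff_radialSum c m (n := ((⊤ : ℕ∞) : WithTop ℕ∞))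
    refine ContDiffOn.div (ContDiff.contDiffOn ?_) (ContDiff.contDiffOn ?_) fun p hp => hp
    · fun_prop
    · fun_prop
  | succ k ih =>
    exact (ih.fderiv_of_isOpen (isOpen_polarDomain c m) (m := ((⊤ : ℕ∞) : WithTop ℕ∞))
      (by simp)).clm_apply contDiffOn_const

theorem hasDerivAt_polarDeriv {c : ℕ → ℝ} {m : ℕ} (k : ℕ) {s φ ε : ℝ}
    (h : (s, φ, ε) ∈ polarDomain c m) :
    HasDerivAt (fun s => polarDeriv c m k (s, φ, ε)) (polarDeriv c m (k + 1) (s, φ, ε)) s := by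
  have hd : HasFDerivAt (polarDeriv c m k) (fderiv ℝ (polarDeriv c m k) (s, φ, ε)) (s, φ, ε) :=
    (((contDiffOn_polarDeriv c m k).contDiffAt
      ((isOpen_polarDomain c m).mem_nhds h)).differentiableAt (by simp)).hasFDerivAt
  exact hd.comp_hasDerivAt s ((hasDerivAt_id s).prodMk
    ((hasDerivAt_const s φ).prodMk (hasDerivAt_const s ε)))

theorem abs_radialSum_le (c : ℕ → ℝ) (m : ℕ) (s φ : ℝ) :
    |radialSum c m s φ| ≤ ∑ e ∈ Finset.range m, |c e| * Real.exp (e * s) := by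
  refine (Finset.abs_sum_le_sum_abs _ _).trans (Finset.sum_le_sum fun e _ => ?_)
  rw [abs_mul, abs_mul, abs_of_pos (Real.exp_pos _), abs_pow]
  exact mul_le_of_le_one_right (by positivity)
    (pow_le_one₀ (abs_nonneg _) (Real.abs_cos_le_one _))

/-- For small `ε` the angular velocity is at least `1 / 2` near the circle of radius `exp s₀`. -/
theorem exists_angular_bound (c : ℕ → ℝ) (m : ℕ) (s₀ : ℝ) :
    ∃ ε₀ > 0, ∀ s φ ε, |s - s₀| ≤ 1 → |ε| ≤ ε₀ →
      1 / 2 ≤ 1 + ε * (Real.sin φ * radialSum c m s φ) := by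
  set B := ∑ e ∈ Finset.range m, |c e| * Real.exp (e * (s₀ + 1)) with hB
  have hB0 : 0 ≤ B := Finset.sum_nonneg fun e _ => by positivity
  -- `B + 1` rather than `B`, since `B` may be zero.
  refine ⟨1 / (2 * (B + 1)), by positivity, fun s φ ε hs hε => ?_⟩
  have h1 : |radialSum c m s φ| ≤ B := (abs_radialSum_le c m s φ).trans
    (Finset.sum_le_sum fun e _ => by
      have := (abs_le.1 hs).2
      gcongr
      linarith)
  have h2 : |ε * (Real.sin φ * radialSum c m s φ)| ≤ 1 / (2 * (B + 1)) * (1 * (B + 1)) := by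
    rw [abs_mul, abs_mul]
    gcongr
    · exact Real.abs_sin_le_one φ
    · linarith
  have h3 : 1 / (2 * (B + 1)) * (1 * (B + 1)) = 1 / 2 := by field_simp
  have := (abs_le.1 (h2.trans h3.le)).1
  linarith

theorem isDerivFamily_polarDeriv {c : ℕ → ℝ} {m : ℕ} {s₀ ε₀ : ℝ} (hε₀ : 0 < ε₀)
    (h : ∀ s φ ε, |s - s₀| ≤ 1 → |ε| ≤ ε₀ → 1 / 2 ≤ 1 + ε * (Real.sin φ * radialSum c m s φ)) :
    IsDerivFamily (polarDeriv c m) s₀ ε₀ where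
  pos := hε₀
  hasDerivAt k s φ ε hs hε := hasDerivAt_polarDeriv k
    (show _ ≠ _ from (lt_of_lt_of_le one_half_pos (h s φ ε hs hε)).ne')
  continuousAt k s φ ε hs hε := (contDiffOn_polarDeriv c m k).continuousOn.continuousAt
    ((isOpen_polarDomain c m).mem_nhds
      (show _ ≠ _ from (lt_of_lt_of_le one_half_pos (h s φ ε hs hε)).ne'))

/-- At `ε = 0` the denominator of `polarField` is `1`, and each derivative in `s` brings down a
factor `e` from `exp (e * s)`. In the variable `exp s` this is the Euler operator, which is how
multiplicities are read off later. -/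
theorem polarDeriv_zero_param (c : ℕ → ℝ) (m k : ℕ) (s φ : ℝ) :
    polarDeriv c m k (s, φ, 0) =
      -∑ e ∈ Finset.range m, c e * (e : ℝ) ^ k * Real.exp (e * s) * Real.cos φ ^ (e + 2) := by
  induction k generalizing s with
  | zero =>
    simp only [polarDeriv, polarField, zero_mul, add_zero, div_one, pow_zero, mul_one]
    rw [radialSum, Finset.mul_sum]
    congr 1
    exact Finset.sum_congr rfl fun e _ => by ring
  | succ k ih =>
    have h1 := hasDerivAt_polarDeriv (c := c) (m := m) k (s := s) (φ := φ) (ε := 0)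
      (by simp [polarDomain])
    simp only [ih] at h1
    refine h1.unique ?_
    refine (HasDerivAt.fun_sum (u := Finset.range m) fun e _ => ?_).neg
    have h2 : HasDerivAt (fun s : ℝ => (e : ℝ) * s) ((e : ℝ) * 1) s :=
      (hasDerivAt_id s).const_mul _
    refine ((h2.exp.const_mul (c e * (e : ℝ) ^ k)).mul_const
      (Real.cos φ ^ (e + 2))).congr_deriv ?_
    ring

/-- The averages of the powers of the cosine. -/
noncomputable def cosMean (n : ℕ) : ℝ := ∫ φ in (0)..(2 * Real.pi), Real.cos φ ^ n

theorem cosMean_succ_succ (n : ℕ) : cosMean (n + 2) = (n + 1) / (n + 2) * cosMean n := by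
  simp [cosMean, integral_cos_pow]

theorem cosMean_odd (j : ℕ) : cosMean (2 * j + 1) = 0 := by
  induction j with
  | zero => simp [cosMean]
  | succ j ih =>
    rw [show 2 * (j + 1) + 1 = 2 * j + 1 + 2 by ring, cosMean_succ_succ, ih, mul_zero]

theorem cosMean_even_pos (j : ℕ) : 0 < cosMean (2 * j) := by
  induction j with
  | zero => simp [cosMean, Real.pi_pos]
  | succ j ih =>
    rw [show 2 * (j + 1) = 2 * j + 2 by ring, cosMean_succ_succ]
    positivity

theorem integral_polarDeriv (c : ℕ → ℝ) (m k : ℕ) (s : ℝ) :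
    ∫ φ in (0)..(2 * Real.pi), polarDeriv c m k (s, φ, 0) =
      -∑ e ∈ Finset.range m, c e * (e : ℝ) ^ k * Real.exp (e * s) * cosMean (e + 2) := by
  simp only [polarDeriv_zero_param, intervalIntegral.integral_neg]
  rw [intervalIntegral.integral_finsetSum fun e _ => Continuous.intervalIntegrable
    (by fun_prop) _ _]
  simp only [intervalIntegral.integral_const_mul, cosMean]

/-- Only the odd part of `F` contributes to the averages. -/
theorem sum_range_odd_cosMean (c : ℕ → ℝ) (N k : ℕ) (s : ℝ) :
    ∑ e ∈ Finset.range (2 * N + 1), c e * (e : ℝ) ^ k * Real.exp (e * s) * cosMean (e + 2) =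
      2 ^ k * ∑ j ∈ Finset.range (N + 1),
        c (2 * j) * cosMean (2 * (j + 1)) * (j : ℝ) ^ k * (Real.exp s ^ 2) ^ j := by
  have key : ∀ j : ℕ, c (2 * j) * ((2 * j : ℕ) : ℝ) ^ k * Real.exp ((2 * j : ℕ) * s) *
      cosMean (2 * j + 2) =
      2 ^ k * (c (2 * j) * cosMean (2 * (j + 1)) * (j : ℝ) ^ k * (Real.exp s ^ 2) ^ j) := by
    intro j
    rw [← pow_mul, ← Real.exp_nat_mul]
    push_cast
    rw [mul_pow, mul_add, mul_one]
    ring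
  induction N with
  | zero => simpa using key 0
  | succ N ih =>
    rw [show 2 * (N + 1) + 1 = 2 * N + 1 + 1 + 1 by ring, Finset.sum_range_succ,
      Finset.sum_range_succ, ih, Finset.sum_range_succ _ (N + 1), mul_add, ← key (N + 1),
      show 2 * N + 1 + 2 = 2 * (N + 1) + 1 by ring, cosMean_odd]
    simp only [mul_zero, add_zero]
    rfl

/-- Clusters of `k + 1 ≤ 4` periodic solutions force the averaged function and its first `k`
derivatives to vanish. -/
theorem average_eq_zero_of_clusters {c : ℕ → ℝ} {N k : ℕ} {s₀ : ℝ} (hk : k < 4)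
    (hv : HasSolClusters (polarDeriv c (2 * N + 1)) s₀ (k + 1)) :
    ∑ j ∈ Finset.range (N + 1),
      c (2 * j) * cosMean (2 * (j + 1)) * (j : ℝ) ^ k * (Real.exp s₀ ^ 2) ^ j = 0 := by
  obtain ⟨ε₀, hε₀, h⟩ := exists_angular_bound c (2 * N + 1) s₀
  have hD := isDerivFamily_polarDeriv hε₀ h
  have h0 : ∫ φ in (0)..(2 * Real.pi), polarDeriv c (2 * N + 1) k (s₀, φ, 0) = 0 := by
    interval_cases k
    · exact hD.integral_zero hv
    · exact hD.integral_one hv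
    · exact hD.integral_two hv
    · exact hD.integral_three hv
  rw [integral_polarDeriv, neg_eq_zero, sum_range_odd_cosMean] at h0
  exact (mul_eq_zero.1 h0).resolve_left (by positivity)

theorem polarField_periodic (c : ℕ → ℝ) (m : ℕ) (s φ ε : ℝ) :
    polarField c m (s, φ + 2 * Real.pi, ε) = polarField c m (s, φ, ε) := by
  simp [polarField, radialSum]

/-! ### Closed orbits as periodic solutions of the polar equation -/

/-- A nowhere vanishing complex curve has a logarithm along which derivatives are explicit. -/
theorem exists_log_lift {Z Z' : ℝ → ℂ} (hZ : ∀ t, HasDerivAt Z (Z' t) t) (hZ' : Continuous Z')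
    (h0 : ∀ t, Z t ≠ 0) :
    ∃ W : ℝ → ℂ, (∀ t, HasDerivAt W (Z' t / Z t) t) ∧ ∀ t, Z t = Complex.exp (W t) := by
  have hZc : Continuous Z := continuous_iff_continuousAt.2 fun t => (hZ t).continuousAt
  have hq : Continuous fun t => Z' t / Z t := hZ'.div hZc h0
  set W : ℝ → ℂ := fun t => Complex.log (Z 0) + ∫ u in (0)..t, Z' u / Z u with hW
  have hWd : ∀ t, HasDerivAt W (Z' t / Z t) t := fun t =>
    ((hq.integral_hasStrictDerivAt 0 t).hasDerivAt).const_add _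
  refine ⟨W, hWd, fun t => ?_⟩
  have hd : ∀ t, HasDerivAt (fun t => Z t * Complex.exp (-W t)) 0 t := fun t => by
    refine ((hZ t).mul (hWd t).neg.cexp).congr_deriv ?_
    have := h0 t
    field_simp
    ring
  have hconst := is_const_of_deriv_eq_zero (fun t => (hd t).differentiableAt)
    (fun t => (hd t).deriv) t 0
  have hW0 : W 0 = Complex.log (Z 0) := by simp [hW]
  rw [hW0, Complex.exp_neg, Complex.exp_neg, Complex.exp_log (h0 0), mul_inv_cancel₀ (h0 0),
    mul_inv_eq_one₀ (Complex.exp_ne_zero _)] at hconst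
  exact hconst

/-- A function whose derivative is at least `1 / 2` has a differentiable inverse. -/
theorem exists_inverse_of_half_le_deriv {f f' : ℝ → ℝ} (hf : ∀ t, HasDerivAt f (f' t) t)
    (h : ∀ t, 1 / 2 ≤ f' t) :
    StrictMono f ∧ ∃ τ : ℝ → ℝ, (∀ t, τ (f t) = t) ∧ (∀ x, f (τ x) = x) ∧
      ∀ x, HasDerivAt τ (f' (τ x))⁻¹ x := by
  have hmono : StrictMono f := strictMono_of_deriv_pos fun t => by
    rw [(hf t).deriv]; linarith [h t]
  have hc : Continuous f := continuous_iff_continuousAt.2 fun t => (hf t).continuousAt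
  -- Monotonicity of `f t - t / 2` gives linear growth in both directions, hence surjectivity.
  have hg : ∀ t, HasDerivAt (fun t => f t - 1 / 2 * t) (f' t - 1 / 2 * 1) t := fun t =>
    (hf t).sub ((hasDerivAt_id t).const_mul _)
  have hgm : Monotone fun t => f t - 1 / 2 * t :=
    monotone_of_deriv_nonneg (fun t => (hg t).differentiableAt) fun t => by
      rw [(hg t).deriv]; linarith [h t]
  have htop : Tendsto f atTop atTop := by
    refine tendsto_atTop_mono' _ (f₁ := fun t => f 0 + 1 / 2 * t) ?_
      (tendsto_atTop_add_const_left _ _ (tendsto_id.const_mul_atTop one_half_pos))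
    filter_upwards [eventually_ge_atTop 0] with t ht
    have := hgm ht
    simp only at this
    linarith
  have hbot : Tendsto f atBot atBot := by
    refine tendsto_atBot_mono' _ (f₁ := fun t => f 0 + 1 / 2 * t) ?_
      (tendsto_atBot_add_const_left _ _ (tendsto_id.const_mul_atBot one_half_pos))
    filter_upwards [eventually_le_atBot 0] with t ht
    have := hgm ht
    simp only at this
    linarith
  let e := hmono.orderIsoOfSurjective f (hc.surjective htop hbot)
  have he : ∀ x, f (e.symm x) = x := fun x => e.apply_symm_apply x
  refine ⟨hmono, e.symm, fun t => e.symm_apply_apply t, he, fun x => ?_⟩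
  exact HasDerivAt.of_local_left_inverse e.symm.continuous.continuousAt (hf _)
    (by linarith [h (e.symm x)]) (Eventually.of_forall he)

/-- A closed orbit near the circle of radius `exp s₀` is the graph of a `2π`-periodic solution
of the polar equation. -/
theorem exists_periodicSol_of_closedOrbit {c : ℕ → ℝ} {m : ℕ} {s₀ ε₀ ε δ : ℝ} (hε₀ : 0 < ε₀)
    (h : ∀ s φ ε, |s - s₀| ≤ 1 → |ε| ≤ ε₀ → 1 / 2 ≤ 1 + ε * (Real.sin φ * radialSum c m s φ))
    (hε : |ε| ≤ ε₀) (hδ : δ ≤ 1) {Γ : Set (ℝ × ℝ)}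
    (hΓ : IsClosedOrbit (fun p => (p.2 - ε * ∑ e ∈ Finset.range m, c e * p.1 ^ (e + 1), -p.1)) Γ)
    (hpos : ∀ p ∈ Γ, p ≠ 0)
    (hnear : ∀ p ∈ Γ, |Real.log (p.1 ^ 2 + p.2 ^ 2) / 2 - s₀| ≤ δ) :
    ∃ v : ℝ → ℝ, IsPeriodicSol (polarDeriv c m) ε v ∧ (∀ φ, |v φ - s₀| ≤ δ) ∧
      Γ = Set.range fun φ => (Real.exp (v φ) * Real.cos φ, -(Real.exp (v φ) * Real.sin φ)) := by
  obtain ⟨γ, T, hγ, hT, hper, -, rfl⟩ := hΓ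
  set F : ℝ → ℝ := fun x => ∑ e ∈ Finset.range m, c e * x ^ (e + 1) with hF
  have hFc : Continuous F := by fun_prop
  have hγc : Continuous γ := continuous_iff_continuousAt.2 fun t => (hγ t).continuousAt
  have hx : ∀ t, HasDerivAt (fun t => (γ t).1) ((γ t).2 - ε * F (γ t).1) t := fun t =>
    (hasFDerivAt_fst (p := γ t)).comp_hasDerivAt t (hγ t)
  have hy : ∀ t, HasDerivAt (fun t => (γ t).2) (-(γ t).1) t := fun t =>
    (hasFDerivAt_snd (p := γ t)).comp_hasDerivAt t (hγ t)
  obtain ⟨W, hW, hexp⟩ := exists_log_lift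
    (Z := fun t => ((γ t).1 : ℂ) + ((γ t).2 : ℂ) * Complex.I)
    (Z' := fun t => (((γ t).2 - ε * F (γ t).1 : ℝ) : ℂ) + ((-(γ t).1 : ℝ) : ℂ) * Complex.I)
    (fun t => (hx t).ofReal_comp.add ((hy t).ofReal_comp.mul_const _))
    (by fun_prop)
    -- The origin is excluded by `hpos` and not by `hnear`, because `Real.log 0 = 0`.
    (fun t ht => hpos (γ t) ⟨t, rfl⟩ (by
      have h1 := congrArg Complex.re ht
      have h2 := congrArg Complex.im ht
      simp at h1 h2
      exact Prod.ext h1 h2))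
  set s : ℝ → ℝ := fun t => (W t).re with hs
  -- The sign makes the angle increase along orbits, since the rotation is clockwise.
  set f : ℝ → ℝ := fun t => -(W t).im with hf
  have hx' : ∀ t, (γ t).1 = Real.exp (s t) * Real.cos (f t) := fun t => by
    have := congrArg Complex.re (hexp t)
    simpa [Complex.exp_re, hs, hf] using this
  have hy' : ∀ t, (γ t).2 = -(Real.exp (s t) * Real.sin (f t)) := fun t => by
    have := congrArg Complex.im (hexp t)
    simpa [Complex.exp_im, hs, hf] using this
  have hFr : ∀ t, F (γ t).1 = Real.exp (s t) * radialSum c m (s t) (f t) := fun t => by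
    rw [hF, radialSum, Finset.mul_sum]
    refine Finset.sum_congr rfl fun e _ => ?_
    rw [hx', Real.exp_nat_mul]
    ring
  have hsd : ∀ t, HasDerivAt s (-(ε * (Real.cos (f t) * radialSum c m (s t) (f t)))) t := by
    intro t
    refine (Complex.reCLM.hasFDerivAt.comp_hasDerivAt t (hW t)).congr_deriv ?_
    have := Real.exp_pos (s t)
    have h1 := Real.sin_sq_add_cos_sq (f t)
    simp only [Complex.reCLM_apply, Complex.div_re, Complex.normSq_add_mul_I]
    simp only [hFr, Complex.add_re, Complex.add_im, Complex.mul_re, Complex.mul_im,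
      Complex.ofReal_re, Complex.ofReal_im, Complex.I_re, Complex.I_im]
    simp only [hx', hy']
    rw [show (Real.exp (s t) * Real.cos (f t)) ^ 2 + (-(Real.exp (s t) * Real.sin (f t))) ^ 2 =
      Real.exp (s t) ^ 2 by linear_combination Real.exp (s t) ^ 2 * h1]
    field_simp
    ring
  have hfd : ∀ t, HasDerivAt f (1 + ε * (Real.sin (f t) * radialSum c m (s t) (f t))) t := by
    intro t
    refine ((Complex.imCLM.hasFDerivAt.comp_hasDerivAt t (hW t)).neg).congr_deriv ?_
    have := Real.exp_pos (s t)
    have h1 := Real.sin_sq_add_cos_sq (f t)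
    simp only [Complex.imCLM_apply, Complex.div_im, Complex.normSq_add_mul_I]
    simp only [hFr, Complex.add_re, Complex.add_im, Complex.mul_re, Complex.mul_im,
      Complex.ofReal_re, Complex.ofReal_im, Complex.I_re, Complex.I_im]
    simp only [hx', hy']
    rw [show (Real.exp (s t) * Real.cos (f t)) ^ 2 + (-(Real.exp (s t) * Real.sin (f t))) ^ 2 =
      Real.exp (s t) ^ 2 by linear_combination Real.exp (s t) ^ 2 * h1]
    field_simp
    linear_combination Real.exp (s t) ^ 2 * h1
  have hsδ : ∀ t, |s t - s₀| ≤ δ := fun t => by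
    have h1 := Real.sin_sq_add_cos_sq (f t)
    have h2 := hnear (γ t) ⟨t, rfl⟩
    rwa [hx', hy', show (Real.exp (s t) * Real.cos (f t)) ^ 2 +
      (-(Real.exp (s t) * Real.sin (f t))) ^ 2 = Real.exp (s t) ^ 2 by
        linear_combination Real.exp (s t) ^ 2 * h1, Real.log_pow, Real.log_exp,
      Nat.cast_ofNat, mul_div_cancel_left₀ _ (two_ne_zero)] at h2
  obtain ⟨hmono, τ, hτf, hfτ, hτd⟩ := exists_inverse_of_half_le_deriv hfd
    fun t => h (s t) (f t) ε ((hsδ t).trans hδ) hε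
  set v : ℝ → ℝ := fun φ => s (τ φ) with hv
  have hvδ : ∀ φ, |v φ - s₀| ≤ δ := fun φ => hsδ _
  have hvd : ∀ φ, HasDerivAt v (ε * polarDeriv c m 0 (v φ, φ, ε)) φ := by
    intro φ
    refine ((hsd (τ φ)).comp φ (hτd φ)).congr_deriv ?_
    simp only [hfτ, polarDeriv, polarField, hv]
    ring
  have hrange : Set.range γ =
      Set.range fun φ => (Real.exp (v φ) * Real.cos φ, -(Real.exp (v φ) * Real.sin φ)) := by
    ext p
    constructor
    · rintro ⟨t, rfl⟩
      exact ⟨f t, by simp only [hv, hτf]; rw [← hx', ← hy']⟩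
    · rintro ⟨φ, rfl⟩
      refine ⟨τ φ, Prod.ext ?_ ?_⟩
      · rw [hx', hfτ]
      · rw [hy', hfτ]
  refine ⟨v, ⟨hvd, ?_⟩, hvδ, hrange⟩
  have hD := isDerivFamily_polarDeriv hε₀ h
  -- The translate of `v` by `2π` solves the same equation. If it differed from `v` at one point, it
  -- would lie strictly on one side of `v` everywhere, and `v` would be strictly monotone along
  -- steps of `2π`. This contradicts the return of the orbit after `n` turns, so injectivity of `γ`
  -- on a period is not needed.
  have hwd : ∀ φ, HasDerivAt (fun φ => v (φ + 2 * Real.pi))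
      (ε * polarDeriv c m 0 (v (φ + 2 * Real.pi), φ, ε)) φ := fun φ => by
    have := (hvd (φ + 2 * Real.pi)).comp_add_const φ (2 * Real.pi)
    rwa [polarDeriv, polarField_periodic] at this
  have hv1 : ∀ φ, |v φ - s₀| ≤ 1 := fun φ => (hvδ φ).trans hδ
  obtain ⟨n, hn, hvn⟩ : ∃ n : ℕ, 0 < n ∧ v (f 0 + n * (2 * Real.pi)) = v (f 0) := by
    have hWT : Complex.exp (W T) = Complex.exp (W 0) := by
      rw [← hexp, ← hexp]
      have := hper 0
      rw [zero_add] at this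
      rw [this]
    obtain ⟨k, hk⟩ := Complex.exp_eq_exp_iff_exists_int.1 hWT
    have hsT : s T = s 0 := by
      simp only [hs, hk]; simp
    have hfT : f T = f 0 - k * (2 * Real.pi) := by
      simp only [hf, hk]; simp; ring
    -- The angle is strictly increasing and `T > 0`, so the winding cannot be zero.
    have hk0 : k < 0 := by
      have := hmono hT
      rw [hfT] at this
      have h2 : (k : ℝ) * (2 * Real.pi) < 0 := by linarith
      have h3 : (k : ℝ) < 0 := by
        by_contra! hc
        exact absurd h2 (not_lt.2 (by positivity))
      exact_mod_cast h3
    refine ⟨(-k).toNat, by omega, ?_⟩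
    have hcast : (((-k).toNat : ℕ) : ℝ) = -(k : ℝ) := by
      have : (((-k).toNat : ℕ) : ℤ) = -k := Int.toNat_of_nonneg (by omega)
      exact_mod_cast this
    rw [hcast, show f 0 + -(k : ℝ) * (2 * Real.pi) = f T by rw [hfT]; ring]
    simp only [hv, hτf, hsT]
  have hiter : ∀ k : ℕ, ∀ φ, v (φ + ((k + 1 : ℕ) : ℝ) * (2 * Real.pi)) =
      v ((φ + k * (2 * Real.pi)) + 2 * Real.pi) := fun k φ => by
    congr 1; push_cast; ring
  intro φ
  rcases lt_trichotomy (v φ) (v (φ + 2 * Real.pi)) with hlt | heq | hlt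
  · have hall := hD.sol_lt hε hvd hwd hv1 (fun φ => hv1 _) hlt
    have := strictMono_nat_of_lt_succ (f := fun n : ℕ => v (f 0 + n * (2 * Real.pi)))
      (fun k => by rw [hiter]; exact hall _) hn
    simp only [Nat.cast_zero, zero_mul, add_zero] at this
    exact absurd hvn this.ne'
  · exact heq.symm
  · have hall := hD.sol_lt hε hwd hvd (fun φ => hv1 _) hv1 hlt
    have := strictAnti_nat_of_succ_lt (f := fun n : ℕ => v (f 0 + n * (2 * Real.pi)))
      (fun k => by rw [hiter]; exact hall _) hn
    simp only [Nat.cast_zero, zero_mul, add_zero] at this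
    exact absurd hvn this.ne

/-! ### From limit cycles to zeros of the averaged function -/

theorem isCompact_originCircle (r : ℝ) : IsCompact (originCircle r) := by
  refine Metric.isCompact_of_isClosed_isBounded ?_ ?_
  · exact isClosed_eq (by fun_prop) continuous_const
  · refine (Metric.isBounded_closedBall (x := (0 : ℝ × ℝ)) (r := |r|)).subset fun p hp => ?_
    have hp' : p.1 ^ 2 + p.2 ^ 2 = r ^ 2 := hp
    rw [mem_closedBall_zero_iff, Prod.norm_def]
    exact max_le (sq_le_sq.1 (by nlinarith [sq_nonneg p.2]))
      (sq_le_sq.1 (by nlinarith [sq_nonneg p.1]))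

/-- Sets that tend to the circle of radius `ρ` eventually lie in thin annuli. -/
theorem eventually_subset_annulus {ι : Type*} {l : Filter ι} {Γ : ι → Set (ℝ × ℝ)} {ρ : ℝ}
    (hρ : 0 < ρ) (h : Tendsto (fun i => Metric.hausdorffEDist (Γ i) (originCircle ρ)) l (𝓝 0))
    {δ : ℝ} (hδ : 0 < δ) :
    ∀ᶠ i in l, ∀ p ∈ Γ i, p ≠ 0 ∧ |Real.log (p.1 ^ 2 + p.2 ^ 2) / 2 - Real.log ρ| ≤ δ := by
  set O : Set (ℝ × ℝ) := {p | Real.exp (2 * (Real.log ρ - δ)) < p.1 ^ 2 + p.2 ^ 2} ∩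
    {p | p.1 ^ 2 + p.2 ^ 2 < Real.exp (2 * (Real.log ρ + δ))} with hO
  have hOo : IsOpen O := (isOpen_lt continuous_const (by fun_prop)).inter
    (isOpen_lt (by fun_prop) continuous_const)
  have hsub : originCircle ρ ⊆ O := by
    intro p hp
    have hp' : p.1 ^ 2 + p.2 ^ 2 = Real.exp (2 * Real.log ρ) := by
      rw [two_mul, Real.exp_add, Real.exp_log hρ, ← sq]; exact hp
    simp only [hO, Set.mem_inter_iff, Set.mem_ofPred_eq, hp', Real.exp_lt_exp]
    constructor <;> linarith
  obtain ⟨η, hη, hηO⟩ := (isCompact_originCircle ρ).exists_thickening_subset_open hOo hsub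
  filter_upwards [h.eventually (gt_mem_nhds (ENNReal.ofReal_pos.2 hη))] with i hi p hp
  have hpO : p ∈ O := hηO (by
    rw [Metric.mem_thickening_iff_infEDist_lt]
    exact (Metric.infEDist_le_hausdorffEDist_of_mem hp).trans_lt hi)
  have hpos : 0 < p.1 ^ 2 + p.2 ^ 2 := (Real.exp_pos _).trans hpO.1
  refine ⟨fun h0 => ?_, ?_⟩
  · simp [h0] at hpos
  · have h1 := (Real.lt_log_iff_exp_lt hpos).2 hpO.1
    have h2 := (Real.log_lt_iff_lt_exp hpos).2 hpO.2
    rw [abs_le]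
    constructor <;> linarith

variable {V : Type*} [Fintype V] {W : Weights} {G : SimpleGraph V} {c : ℕ → ℝ} {m n : ℕ}

/-- The limit cycles near one circle are clusters of solutions of the polar equation. -/
theorem IsAssociated.hasSolClusters {r : Fin n → ℝ} (hA : IsAssociated W G r)
    (hfield : ∀ ε, lienardField W G ε =
      fun p => (p.2 - ε * ∑ e ∈ Finset.range m, c e * p.1 ^ (e + 1), -p.1))
    {ρ : ℝ} (hρ : 0 < ρ) {k : ℕ} (hk : k ≤ (Finset.univ.filter fun j => r j = ρ).card) :
    HasSolClusters (polarDeriv c m) (Real.log ρ) k := by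
  intro δ hδ
  obtain ⟨ε₀, hε₀, hang⟩ := exists_angular_bound c m (Real.log ρ)
  have hD := isDerivFamily_polarDeriv hε₀ hang
  obtain ⟨Γ, hcyc, hlim⟩ := hA
  have hδ1 : 0 < min δ 1 := lt_min hδ one_pos
  have hann : ∀ᶠ ε in 𝓝[≠] (0 : ℝ), ∀ j, r j = ρ → ∀ p ∈ Γ j ε, p ≠ 0 ∧
      |Real.log (p.1 ^ 2 + p.2 ^ 2) / 2 - Real.log ρ| ≤ min δ 1 := by
    refine eventually_all.2 fun j => ?_
    by_cases hj : r j = ρ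
    · have hl := hlim j
      rw [hj] at hl
      filter_upwards [eventually_subset_annulus hρ hl hδ1] with ε h _ using h
    · exact Eventually.of_forall fun ε h => absurd h hj
  have hsmall : ∀ᶠ ε in 𝓝[≠] (0 : ℝ), |ε| ≤ min δ ε₀ := by
    refine eventually_nhdsWithin_of_eventually_nhds ?_
    filter_upwards [Metric.closedBall_mem_nhds (0 : ℝ) (lt_min hδ hε₀)] with ε hε
    simpa using hε
  obtain ⟨ε, ⟨⟨hcl, hinj⟩, hpts⟩, hεδ, hε0⟩ :=
    ((hcyc.and hann).and (hsmall.and self_mem_nhdsWithin)).exists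
  have hε₁ : |ε| ≤ ε₀ := hεδ.trans (min_le_right _ _)
  set J := Finset.univ.filter fun j => r j = ρ with hJ
  have hex : ∀ j : J, ∃ v : ℝ → ℝ, IsPeriodicSol (polarDeriv c m) ε v ∧
      (∀ φ, |v φ - Real.log ρ| ≤ min δ 1) ∧ Γ j ε = Set.range fun φ =>
        (Real.exp (v φ) * Real.cos φ, -(Real.exp (v φ) * Real.sin φ)) := fun j => by
    have hj : r j = ρ := (Finset.mem_filter.1 j.2).2
    refine exists_periodicSol_of_closedOrbit hε₀ hang hε₁ (min_le_right _ _) ?_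
      (fun p hp => (hpts j hj p hp).1) (fun p hp => (hpts j hj p hp).2)
    rw [← hfield]
    exact (hcl j).1
  choose v hv hvδ hΓ using hex
  have hv1 : ∀ j φ, |v j φ - Real.log ρ| ≤ 1 := fun j φ => (hvδ j φ).trans (min_le_right _ _)
  -- Solutions that agree at angle `0` coincide and would give the same orbit. Hence sorting by the
  -- values at `0` orders the solutions everywhere.
  have hv0 : Function.Injective fun j => v j 0 := fun i j hij => by
    have hvv := hD.sol_unique hε₁ (hv i).hasDerivAt (hv j).hasDerivAt (hv1 i) (hv1 j) hij
    have hΓΓ : Γ i ε = Γ j ε := by rw [hΓ, hΓ, hvv]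
    exact Subtype.ext (hinj hΓΓ)
  obtain ⟨A, hAsub, hAcard⟩ := Finset.exists_subset_card_eq
    (s := Finset.univ.image fun j => v j 0) (n := k) (by
      rwa [Finset.card_image_of_injective _ hv0, Finset.card_univ, Fintype.card_coe])
  have hidx : ∀ i : Fin k, ∃ j, v j 0 = A.orderEmbOfFin hAcard i := fun i => by
    have := hAsub (A.orderEmbOfFin_mem hAcard i)
    simpa using this
  choose idx hidx using hidx
  refine ⟨ε, hε0, hεδ.trans (min_le_left _ _), fun i => v (idx i), fun i => hv _,
    fun i φ => (hvδ _ φ).trans (min_le_left _ _), fun φ i j hij => ?_⟩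
  refine hD.sol_lt hε₁ (hv _).hasDerivAt (hv _).hasDerivAt (hv1 _) (hv1 _) (φ₀ := 0) ?_ φ
  rw [hidx, hidx]
  exact (A.orderEmbOfFin hAcard).strictMono hij

/-- The averaged function vanishes at `ρ ^ 2` at least to the order of the number of limit cycles
that tend to the circle of radius `ρ` (for orders up to four). -/
theorem IsAssociated.average_eq_zero {N : ℕ} {r : Fin n → ℝ} (hA : IsAssociated W G r)
    (hfield : ∀ ε, lienardField W G ε =
      fun p => (p.2 - ε * ∑ e ∈ Finset.range (2 * N + 1), c e * p.1 ^ (e + 1), -p.1))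
    {ρ : ℝ} (hρ : 0 < ρ) {k : ℕ} (hk4 : k < 4)
    (hk : k < (Finset.univ.filter fun j => r j = ρ).card) :
    ∑ j ∈ Finset.range (N + 1),
      c (2 * j) * cosMean (2 * (j + 1)) * (j : ℝ) ^ k * (ρ ^ 2) ^ j = 0 := by
  have := average_eq_zero_of_clusters hk4 (hA.hasSolClusters hfield hρ hk)
  rwa [Real.exp_log hρ] at this

/-! ### Multiplicities of roots and alternating coefficients -/

open Polynomial in
/-- A criterion for multiple roots in terms of the Euler operator `p ↦ X * p'`. -/
theorem pow_dvd_of_euler_eval_eq_zero {u : ℝ} (hu : u ≠ 0) (k : ℕ) (p : ℝ[X])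
    (h : ∀ l < k, eval u ((fun q => X * derivative q)^[l] p) = 0) : (X - C u) ^ k ∣ p := by
  induction k generalizing p with
  | zero => simp
  | succ k ih =>
    have h0 : p.IsRoot u := h 0 k.succ_pos
    have h1 : (X - C u) ^ k ∣ X * derivative p := ih _ fun l hl => by
      simpa using h (l + 1) (Nat.succ_lt_succ hl)
    -- Since `u ≠ 0`, the factor `X` of the Euler operator can be cancelled; passing from `p'` to
    -- `p` then raises the multiplicity by one.
    have hcop : IsCoprime ((X - C u) ^ k) X := by
      refine IsCoprime.pow_left ?_
      simpa using isCoprime_X_sub_C_of_isUnit_sub (R := ℝ) (a := u) (b := 0) (by simpa using hu)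
    have h2 := hcop.dvd_of_dvd_mul_left h1
    by_cases hp : p = 0
    · simp [hp]
    have hmult := derivative_rootMultiplicity_of_root h0
    have hpos := (rootMultiplicity_pos hp).2 h0
    have hp' : derivative p ≠ 0 := fun hd => by
      rw [eq_C_of_derivative_eq_zero hd] at h0 hp
      simp only [IsRoot.def, eval_C] at h0
      simp [h0] at hp
    have h3 := (le_rootMultiplicity_iff hp').2 h2
    exact (le_rootMultiplicity_iff hp).1 (by omega)

open Polynomial in
theorem euler_iterate_eval (b : ℕ → ℝ) (n k : ℕ) (u : ℝ) :
    eval u ((fun q => X * derivative q)^[k] (∑ i ∈ Finset.range n, C (b i) * X ^ i)) =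
      ∑ i ∈ Finset.range n, b i * (i : ℝ) ^ k * u ^ i := by
  have key : (fun q : ℝ[X] => X * derivative q)^[k] (∑ i ∈ Finset.range n, C (b i) * X ^ i) =
      ∑ i ∈ Finset.range n, C (b i * (i : ℝ) ^ k) * X ^ i := by
    induction k with
    | zero => simp
    | succ k ih =>
      rw [Function.iterate_succ_apply', ih, derivative_sum, Finset.mul_sum]
      refine Finset.sum_congr rfl fun i _ => ?_
      rw [derivative_C_mul_X_pow]
      rcases i with _ | i
      · simp
      · simp only [Nat.add_sub_cancel, C_mul, C_pow, pow_succ]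
        ring
  rw [key, eval_finsetSum]
  simp

open Polynomial in
/-- The coefficients of a polynomial with positive roots alternate in sign. -/
theorem coeff_prod_X_sub_C_alternating (s : Multiset ℝ) (hs : ∀ a ∈ s, 0 < a) :
    (∀ i, 0 ≤ (-1) ^ (s.card + i) * (s.map fun a => X - C a).prod.coeff i) ∧
      ∀ i ≤ s.card, 0 < (-1) ^ (s.card + i) * (s.map fun a => X - C a).prod.coeff i := by
  induction s using Multiset.induction_on with
  | empty =>
    constructor
    · intro i
      rcases i with _ | i <;> simp [coeff_one]
    · intro i hi
      obtain rfl : i = 0 := by simpa using hi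
      simp
  | cons a s ih =>
    obtain ⟨ih1, ih2⟩ := ih fun b hb => hs b (Multiset.mem_cons_of_mem hb)
    have ha := hs a (Multiset.mem_cons_self a s)
    set p := (s.map fun a => X - C a).prod
    have h0 : (-1 : ℝ) ^ ((a ::ₘ s).card + 0) * ((X - C a) * p).coeff 0 =
        a * ((-1) ^ (s.card + 0) * p.coeff 0) := by
      simp [sub_mul, pow_succ]
      ring
    have h1 : ∀ i, (-1 : ℝ) ^ ((a ::ₘ s).card + (i + 1)) * ((X - C a) * p).coeff (i + 1) =
        (-1) ^ (s.card + i) * p.coeff i + a * ((-1) ^ (s.card + (i + 1)) * p.coeff (i + 1)) := by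
      intro i
      simp only [sub_mul, coeff_sub, coeff_X_mul, coeff_C_mul, Multiset.card_cons]
      ring
    rw [Multiset.map_cons, Multiset.prod_cons]
    constructor
    · rintro (_ | i)
      · rw [h0]; exact mul_nonneg ha.le (ih1 0)
      · rw [h1]; exact add_nonneg (ih1 i) (mul_nonneg ha.le (ih1 _))
    · rintro (_ | i) hi
      · rw [h0]; exact mul_pos ha (ih2 0 (Nat.zero_le _))
      · rw [h1]
        refine add_pos_of_pos_of_nonneg (ih2 i ?_) (mul_nonneg ha.le (ih1 _))
        simpa using hi

open Polynomial in
/-- If `∑ b i * u ^ i` has degree at most `N`, has no positive root of multiplicity four, and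
vanishes on a family of `N` positive numbers with multiplicities, then its coefficients
alternate in sign. -/
theorem mul_succ_neg_of_roots {N : ℕ} {b : ℕ → ℝ} {t : Fin N → ℝ} (ht : ∀ j, 0 < t j)
    (hroot : ∀ j, ∀ k < 4, k < (Finset.univ.filter fun i => t i = t j).card →
      ∑ i ∈ Finset.range (N + 1), b i * (i : ℝ) ^ k * t j ^ i = 0)
    (hno : ∀ u > 0, ∃ k < 4, ∑ i ∈ Finset.range (N + 1), b i * (i : ℝ) ^ k * u ^ i ≠ 0)
    {i : ℕ} (hi : i < N) : b i * b (i + 1) < 0 := by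
  set p : ℝ[X] := ∑ i ∈ Finset.range (N + 1), C (b i) * X ^ i with hp
  have hcoeff : ∀ i ≤ N, p.coeff i = b i := fun i hi => by
    simp [hp, coeff_C_mul, coeff_X_pow, hi]
  have hp0 : p ≠ 0 := fun h0 => by
    obtain ⟨k, -, hk⟩ := hno 1 one_pos
    refine hk (Finset.sum_eq_zero fun i hi => ?_)
    rw [← hcoeff i (Nat.lt_succ_iff.1 (Finset.mem_range.1 hi)), h0]
    simp
  have hdeg : p.natDegree ≤ N := natDegree_sum_le_of_forall_le _ _ fun i hi =>
    (natDegree_C_mul_X_pow_le _ _).trans (Nat.lt_succ_iff.1 (Finset.mem_range.1 hi))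
  set s : Multiset ℝ := Finset.univ.val.map t with hs
  have hscard : s.card = N := by simp [hs]
  have hcount : ∀ a, s.count a = (Finset.univ.filter fun i => t i = a).card := fun a => by
    rw [hs, Multiset.count_map, Finset.card_def, Finset.filter_val]
    simp only [eq_comm]
  have hle : s ≤ p.roots := by
    rw [Multiset.le_iff_count]
    intro a
    rw [hcount, count_roots, le_rootMultiplicity_iff hp0]
    by_cases ha : ∃ j, t j = a
    · obtain ⟨j, rfl⟩ := ha
      -- `hroot` covers only orders below four. This is enough: four coincident values would produce
      -- a quadruple zero, against `hno`.
      have h3 : (Finset.univ.filter fun i => t i = t j).card < 4 := by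
        by_contra! hge
        obtain ⟨k, hk4, hk⟩ := hno (t j) (ht j)
        exact hk (hroot j k hk4 (hk4.trans_le hge))
      refine pow_dvd_of_euler_eval_eq_zero (ht j).ne' _ _ fun l hl => ?_
      rw [euler_iterate_eval]
      exact hroot j l (hl.trans h3) hl
    · rw [Finset.filter_false_of_mem fun i _ hia => ha ⟨i, hia⟩]
      simp
  obtain ⟨q, hq⟩ := (Multiset.prod_X_sub_C_dvd_iff_le_roots hp0 s).2 hle
  obtain ⟨-, halt⟩ := coeff_prod_X_sub_C_alternating s (by simpa [hs] using ht)
  set w := (s.map fun a => X - C a).prod with hw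
  have hwdeg : w.natDegree = N := by rw [hw, natDegree_multiset_prod_X_sub_C_eq_card, hscard]
  have hw0 : w ≠ 0 := fun h => hp0 (by rw [hq, h, zero_mul])
  have hq0 : q ≠ 0 := fun h => hp0 (by rw [hq, h, mul_zero])
  -- The `N` prescribed roots exhaust the degree, so `p` is a constant times their product.
  have hqdeg : q.natDegree = 0 := by
    have := natDegree_mul hw0 hq0
    rw [← hq] at this
    omega
  rw [eq_C_of_natDegree_eq_zero hqdeg] at hq hq0
  have hqc : 0 < q.coeff 0 ^ 2 := by
    have : q.coeff 0 ≠ 0 := fun h => hq0 (by rw [h, C_0])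
    positivity
  have h1 := halt i (by omega)
  have h2 := halt (i + 1) (by omega)
  rw [← hcoeff i hi.le, ← hcoeff (i + 1) hi, hq, coeff_mul_C, coeff_mul_C]
  have h3 := mul_pos (mul_pos h1 h2) hqc
  have h4 : ((-1 : ℝ) ^ (s.card + i)) ^ 2 = 1 := by rw [← pow_mul, mul_comm, pow_mul]; simp
  rw [show (-1 : ℝ) ^ (s.card + i) * w.coeff i * ((-1) ^ (s.card + (i + 1)) * w.coeff (i + 1)) *
    q.coeff 0 ^ 2 = -(((-1 : ℝ) ^ (s.card + i)) ^ 2 *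
      (w.coeff i * q.coeff 0 * (w.coeff (i + 1) * q.coeff 0))) by ring, h4] at h3
  linarith

/-! ### Coefficients of the reduced boundary polynomial -/

section Coefficients

variable {V : Type*} [Fintype V] (W : Weights)

/-- The value of `weightedCoeff` where there are no sets with the given boundary. -/
noncomputable def defaultCoeff (W : Weights) (n : ℕ) : ℝ :=
  open Classical in
    if 3 < n ∧ Odd n then ∑ l ∈ Finset.Icc 1 ((n - 3) / 2), W.kl l else W.kStar

/-- The coefficients of `x ↦ B_w(G; x, x)`. -/
noncomputable def diagCoeff (W : Weights) (G : SimpleGraph V) (d : ℕ) : ℝ :=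
  ∑ p ∈ Finset.HasAntidiagonal.antidiagonal d, weightedCoeff W G p.1 p.2

theorem weightedBoundaryPoly_diag (G : SimpleGraph V) (x : ℝ) :
    weightedBoundaryPoly W G x x =
      ∑ d ∈ Finset.range (Fintype.card V + 1), diagCoeff W G d * x ^ d := by
  refine Finset.sum_congr rfl fun d _ => ?_
  rw [diagCoeff, Finset.sum_mul]
  refine Finset.sum_congr rfl fun p hp => ?_
  rw [mul_assoc, ← pow_add, Finset.HasAntidiagonal.mem_antidiagonal.1 hp]

theorem mem_boundarySets {G : SimpleGraph V} {i j : ℕ} {S : Finset V} :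
    S ∈ boundarySets G i j ↔ (outerBoundary G S).card = i ∧ S.card = j := by
  simp [boundarySets]

theorem outerBoundary_empty (G : SimpleGraph V) : outerBoundary G ∅ = ∅ := by
  simp [outerBoundary]

theorem weightedCoeff_pos_zero (G : SimpleGraph V) {i : ℕ} (hi : i ≠ 0) :
    weightedCoeff W G i 0 = 0 := by
  simp [weightedCoeff, hi]

theorem weightedCoeff_eq_default {G : SimpleGraph V} {i j : ℕ} (hj : j ≠ 0)
    (h : boundarySets G i j = ∅) :
    weightedCoeff W G i j = defaultCoeff W (Fintype.card V) := by
  simp [weightedCoeff, hj, h, defaultCoeff]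

theorem diagCoeff_zero (G : SimpleGraph V) : diagCoeff W G 0 = 1 := by
  have h : boundarySets G 0 0 = {∅} := by
    ext S
    rw [mem_boundarySets, Finset.mem_singleton]
    constructor
    · exact fun h => Finset.card_eq_zero.1 h.2
    · rintro rfl
      simp [outerBoundary_empty]
  simp [diagCoeff, weightedCoeff, h, Weights.weight]

theorem reducedPoly_eq_sum (G : SimpleGraph V) (x : ℝ) :
    reducedPoly W G x =
      ∑ e ∈ Finset.range (Fintype.card V), diagCoeff W G (e + 1) * x ^ (e + 1) := by
  rw [reducedPoly, weightedBoundaryPoly_diag, Finset.sum_range_succ', diagCoeff_zero]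
  simp

theorem boundarySets_bot (i j : ℕ) :
    boundarySets (⊥ : SimpleGraph V) i j =
      if i = 0 then Finset.powersetCard j Finset.univ else ∅ := by
  ext S
  have h : outerBoundary (⊥ : SimpleGraph V) S = ∅ := by simp [outerBoundary]
  rw [mem_boundarySets, h]
  split_ifs with hi
  · simp [hi]
  · simp [Ne.symm hi]

/-- Boundaries are empty, so only `i = 0` is realised, by sets of odd size and weight `1`. Of the
other pairs on the antidiagonal, `2 j` take the default value and the one with second entry `0`
vanishes by convention. -/
theorem diagCoeff_bot_odd {j : ℕ} (hj : 2 * j + 1 ≤ Fintype.card V) :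
    diagCoeff W (⊥ : SimpleGraph V) (2 * j + 1) =
      (Fintype.card V).choose (2 * j + 1) + 2 * j * defaultCoeff W (Fintype.card V) := by
  have h0 : weightedCoeff W (⊥ : SimpleGraph V) 0 (2 * j + 1) =
      (Fintype.card V).choose (2 * j + 1) := by
    have hne : (Finset.powersetCard (2 * j + 1) (Finset.univ : Finset V)).Nonempty :=
      Finset.powersetCard_nonempty.2 hj
    have hw : ∀ S ∈ Finset.powersetCard (2 * j + 1) (Finset.univ : Finset V),
        W.weight S = 1 := fun S hS => by
      rw [Weights.weight, if_pos (Or.inr ?_)]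
      rw [(Finset.mem_powersetCard.1 hS).2]
      exact odd_two_mul_add_one j
    simp [weightedCoeff, boundarySets_bot, hne, Finset.sum_congr rfl hw]
  have h1 : ∀ i ∈ Finset.range (2 * j), weightedCoeff W (⊥ : SimpleGraph V) (i + 1)
      (2 * j + 1 - (i + 1)) = defaultCoeff W (Fintype.card V) := fun i hi => by
    have := Finset.mem_range.1 hi
    exact weightedCoeff_eq_default W (by omega) (by simp [boundarySets_bot])
  rw [diagCoeff, Finset.Nat.sum_antidiagonal_eq_sum_range_succ_mk, Finset.sum_range_succ',
    Finset.sum_range_succ]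
  dsimp only
  rw [Finset.sum_congr rfl h1, Nat.sub_self, weightedCoeff_pos_zero W _ (Nat.succ_ne_zero _),
    Nat.sub_zero, h0]
  simp
  ring

theorem outerBoundary_top {S : Finset V} (hS : S.Nonempty) :
    (outerBoundary (⊤ : SimpleGraph V) S).card = Fintype.card V - S.card := by
  classical
  rw [← Finset.card_compl]
  congr 1
  ext v
  obtain ⟨u, hu⟩ := hS
  simp only [outerBoundary, Finset.mem_filter, Finset.mem_univ, true_and, Finset.mem_compl,
    SimpleGraph.top_adj]
  exact ⟨fun h => h.1, fun h => ⟨h, u, hu, fun huv => h (huv ▸ hu)⟩⟩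

/-- A nonempty set and its boundary together exhaust the complete graph, so below the top degree no
pair with nonzero second entry is realised. The `d` such pairs all take the default value. -/
theorem diagCoeff_top {d : ℕ} (hd : d < Fintype.card V) (hd0 : d ≠ 0) :
    diagCoeff W (⊤ : SimpleGraph V) d = d * defaultCoeff W (Fintype.card V) := by
  have h1 : ∀ i ∈ Finset.range d, weightedCoeff W (⊤ : SimpleGraph V) i (d - i) =
      defaultCoeff W (Fintype.card V) := fun i hi => by
    have hi' := Finset.mem_range.1 hi
    refine weightedCoeff_eq_default W (by omega) (Finset.eq_empty_of_forall_notMem fun S hS => ?_)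
    obtain ⟨hB, hc⟩ := mem_boundarySets.1 hS
    rw [outerBoundary_top (Finset.card_pos.1 (by omega))] at hB
    omega
  rw [diagCoeff, Finset.Nat.sum_antidiagonal_eq_sum_range_succ_mk, Finset.sum_range_succ]
  dsimp only
  rw [Finset.sum_congr rfl h1, Nat.sub_self, weightedCoeff_pos_zero W _ hd0]
  simp

theorem lienardField_eq (G : SimpleGraph V) (ε : ℝ) :
    lienardField W G ε = fun p => (p.2 - ε * ∑ e ∈ Finset.range (Fintype.card V),
      diagCoeff W G (e + 1) * p.1 ^ (e + 1), -p.1) := by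
  funext p
  have h := diagCoeff_bot_odd W (V := Fin 1) (j := 0) (by simp)
  simp only [Fintype.card_fin, mul_zero, zero_add, Nat.choose_one_right, Nat.cast_one,
    CharP.cast_eq_zero, zero_mul, add_zero] at h
  simp [lienardField, reducedPoly_eq_sum, h]

end Coefficients

/-! ### The degenerate case of the linear centre -/

/-- The linear centre has no limit cycles. -/
theorem not_isLimitCycle_center (Γ : Set (ℝ × ℝ)) :
    ¬ IsLimitCycle (fun p : ℝ × ℝ => (p.2, -p.1)) Γ := by
  rintro ⟨⟨γ, T, hγ, hT, hper, ⟨t₁, ht₁⟩, rfl⟩, U, hU, hΓU, hiso⟩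
  have hγc : Continuous γ := continuous_iff_continuousAt.2 fun t => (hγ t).continuousAt
  have hx : ∀ t, HasDerivAt (fun t => (γ t).1) (γ t).2 t := fun t =>
    (hasFDerivAt_fst (p := γ t)).comp_hasDerivAt t (hγ t)
  have hy : ∀ t, HasDerivAt (fun t => (γ t).2) (-(γ t).1) t := fun t =>
    (hasFDerivAt_snd (p := γ t)).comp_hasDerivAt t (hγ t)
  have hE : ∀ t, HasDerivAt (fun t => (γ t).1 ^ 2 + (γ t).2 ^ 2) 0 t := fun t =>
    (((hx t).pow 2).add ((hy t).pow 2)).congr_deriv (by push_cast; ring)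
  have hconst : ∀ t, (γ t).1 ^ 2 + (γ t).2 ^ 2 = (γ 0).1 ^ 2 + (γ 0).2 ^ 2 := fun t =>
    is_const_of_deriv_eq_zero (fun t => (hE t).differentiableAt) (fun t => (hE t).deriv) t 0
  have hpos : 0 < (γ 0).1 ^ 2 + (γ 0).2 ^ 2 := by
    by_contra! hle
    have hz : ∀ t, γ t = 0 := fun t => by
      have h1 := hconst t
      have h2 : (γ t).1 ^ 2 = 0 := by nlinarith [sq_nonneg (γ t).1, sq_nonneg (γ t).2]
      have h3 : (γ t).2 ^ 2 = 0 := by nlinarith [sq_nonneg (γ t).1, sq_nonneg (γ t).2]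
      exact Prod.ext (pow_eq_zero_iff two_ne_zero |>.1 h2) (pow_eq_zero_iff two_ne_zero |>.1 h3)
    exact ht₁ (by rw [hz, hz])
  have hK : IsCompact (Set.range γ) := hper.compact_of_continuous hT.ne' hγc
  obtain ⟨δ, hδ, hthick⟩ := hK.exists_thickening_subset_open hU hΓU
  obtain ⟨M, hM⟩ := hK.isBounded.exists_norm_le
  have hM0 : 0 ≤ M := (norm_nonneg _).trans (hM (γ 0) ⟨0, rfl⟩)
  -- Rescaling an orbit by `1 + κ` moves its points by at most `κ * M < δ`, so the new closed orbit
  -- stays in `U`; conservation of `x ^ 2 + y ^ 2` shows that it is different.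
  set κ : ℝ := δ / (M + 1) with hκ
  have hκ0 : 0 < κ := by positivity
  have hclosed : IsClosedOrbit (fun p : ℝ × ℝ => (p.2, -p.1))
      (Set.range fun t => (1 + κ) • γ t) := by
    refine ⟨fun t => (1 + κ) • γ t, T, fun t => ?_, hT, fun t => by simp only [hper t],
      ⟨t₁, fun h => ht₁ ?_⟩, rfl⟩
    · refine ((hγ t).const_smul (1 + κ)).congr_deriv ?_
      ext <;> simp
    · exact smul_right_injective _ (by positivity : (1 + κ) ≠ 0) h
  have hsub : (Set.range fun t => (1 + κ) • γ t) ⊆ U := by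
    rintro - ⟨t, rfl⟩
    refine hthick (Metric.mem_thickening_iff.2 ⟨γ t, ⟨t, rfl⟩, ?_⟩)
    dsimp only
    rw [dist_eq_norm, add_smul, one_smul, add_sub_cancel_left, norm_smul, Real.norm_eq_abs,
      abs_of_pos hκ0]
    calc κ * ‖γ t‖ ≤ κ * M := mul_le_mul_of_nonneg_left (hM _ ⟨t, rfl⟩) hκ0.le
      _ < κ * (M + 1) := by nlinarith
      _ = δ := by rw [hκ]; field_simp
  have heq := hiso _ hclosed hsub
  obtain ⟨t, ht⟩ : (1 + κ) • γ 0 ∈ Set.range γ := heq ▸ ⟨0, rfl⟩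
  have h1 := hconst t
  rw [ht] at h1
  simp only [Prod.smul_fst, Prod.smul_snd, smul_eq_mul] at h1
  nlinarith [mul_pos hκ0 hpos, mul_pos (mul_pos hκ0 hκ0) hpos]

/-! ### Unimodality and the exclusion of quadruple zeros -/

theorem choose_succ_mul_real (m k : ℕ) :
    (m.choose (k + 1) : ℝ) * (k + 1) = m.choose k * ((m : ℝ) - k) := by
  rcases le_or_gt k m with hk | hk
  · have := Nat.choose_succ_right_eq m k
    rw [← Nat.cast_sub hk]
    exact_mod_cast this
  · simp [Nat.choose_eq_zero_of_lt hk, Nat.choose_eq_zero_of_lt (hk.trans k.lt_succ_self)]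

theorem choose_odd_succ_mul_real (m j : ℕ) :
    (m.choose (2 * (j + 1) + 1) : ℝ) * ((2 * j + 2) * (2 * j + 3)) =
      m.choose (2 * j + 1) * (((m : ℝ) - (2 * j + 1)) * (m - (2 * j + 2))) := by
  have h1 := choose_succ_mul_real m (2 * j + 1)
  have h2 := choose_succ_mul_real m (2 * j + 2)
  rw [show 2 * (j + 1) + 1 = 2 * j + 2 + 1 by ring]
  push_cast at h1 h2
  rw [show 2 * j + 1 + 1 = 2 * j + 2 by ring] at h1
  linear_combination (2 * j + 2 : ℝ) * h2 + ((m : ℝ) - (2 * j + 2)) * h1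

/-- The sequence `C(m, 2j + 1) / (2j)` is unimodal for `j ≥ 1`. -/
theorem choose_odd_div_unimodal (m : ℕ) {j : ℕ} (hj : 1 ≤ j)
    (h : (m.choose (2 * (j + 1) + 1) : ℝ) / (2 * (j + 1 : ℕ)) ≤
      m.choose (2 * j + 1) / (2 * j)) :
    (m.choose (2 * (j + 2) + 1) : ℝ) / (2 * (j + 2 : ℕ)) ≤
      m.choose (2 * (j + 1) + 1) / (2 * (j + 1 : ℕ)) := by
  have hj' : (1 : ℝ) ≤ j := by exact_mod_cast hj
  have e0 := choose_odd_succ_mul_real m j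
  have e1 := choose_odd_succ_mul_real m (j + 1)
  rcases lt_or_ge m (2 * (j + 1) + 1) with hm | hm
  · rw [Nat.choose_eq_zero_of_lt (show m < 2 * (j + 2) + 1 by omega)]
    simp only [Nat.cast_zero, zero_div]
    positivity
  have hm' : (2 * j + 3 : ℝ) ≤ m := by
    have : 2 * j + 3 ≤ m := by omega
    exact_mod_cast this
  have hA : (0 : ℝ) < m.choose (2 * j + 1) := by
    exact_mod_cast Nat.choose_pos (by omega)
  have hA1 : (0 : ℝ) < m.choose (2 * (j + 1) + 1) := by
    exact_mod_cast Nat.choose_pos hm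
  set A : ℝ := ((m.choose (2 * j + 1) : ℕ) : ℝ)
  set A₁ : ℝ := ((m.choose (2 * (j + 1) + 1) : ℕ) : ℝ)
  rw [show j + 1 + 1 = j + 2 by ring] at e1
  set A₂ : ℝ := ((m.choose (2 * (j + 2) + 1) : ℕ) : ℝ)
  push_cast at h e1 ⊢
  rw [div_le_div_iff₀ (by positivity) (by positivity)] at h ⊢
  set x : ℝ := (j : ℝ)
  set X : ℝ := ((m : ℝ) - (2 * x + 1)) * (m - (2 * x + 2)) with hX
  set Y : ℝ := ((m : ℝ) - (2 * (x + 1) + 1)) * (m - (2 * (x + 1) + 2)) with hY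
  have hYX : Y ≤ X := by rw [hX, hY]; nlinarith
  have hX1 : X * x ≤ (x + 1) * ((2 * x + 2) * (2 * x + 3)) := by
    refine le_of_mul_le_mul_left ?_ hA
    nlinarith [mul_le_mul_of_nonneg_right h (show 0 ≤ (2 * x + 2) * (2 * x + 3) by positivity)]
  have hY1 : Y * (x + 1) ≤ (x + 2) * ((2 * (x + 1) + 2) * (2 * (x + 1) + 3)) := by
    have hx0 : 0 < x := by linarith
    refine le_of_mul_le_mul_left ?_ hx0
    calc x * (Y * (x + 1)) ≤ (x + 1) * (X * x) := by
          nlinarith [mul_le_mul_of_nonneg_left hYX (show 0 ≤ x * (x + 1) by positivity)]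
      _ ≤ (x + 1) * ((x + 1) * ((2 * x + 2) * (2 * x + 3))) :=
          mul_le_mul_of_nonneg_left hX1 (by positivity)
      -- The difference of the two sides is `2 * (4 x ^ 3 + 13 x ^ 2 + 9 x - 3)`, which is
      -- nonnegative for `x ≥ 1`.
      _ ≤ _ := by
          have hx3 : 0 ≤ x ^ 3 := by positivity
          nlinarith [sq_nonneg x, mul_nonneg hx0.le hx0.le]
  have hpos : 0 < (2 * (x + 1) + 2) * (2 * (x + 1) + 3) := by positivity
  refine le_of_mul_le_mul_right ?_ hpos
  nlinarith [mul_le_mul_of_nonneg_left hY1 hA1.le]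

/-- After falling below a level a unimodal sequence stays below it. -/
theorem lt_of_unimodal {f : ℕ → ℝ} (hf : ∀ j ≥ 1, f (j + 1) ≤ f j → f (j + 2) ≤ f (j + 1))
    {κ : ℝ} {p i q : ℕ} (hp : 1 ≤ p) (hpi : p ≤ i) (hiq : i ≤ q) (h1 : κ ≤ f p) (h2 : f i < κ) :
    f q < κ := by
  obtain ⟨j, hpj, hji, hj⟩ : ∃ j, p ≤ j ∧ j < i ∧ f (j + 1) ≤ f j := by
    by_contra! hcon
    have : ∀ l, p ≤ l → l ≤ i → f p ≤ f l := fun l hl => by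
      induction l, hl using Nat.le_induction with
      | base => simp
      | succ l hl ih => exact fun hli => (ih (by omega)).trans (hcon l hl (by omega)).le
    linarith [this i hpi le_rfl]
  have hdesc : ∀ l, j ≤ l → f (l + 1) ≤ f l := fun l hl => by
    induction l, hl using Nat.le_induction with
    | base => exact hj
    | succ l hl ih => exact hf l (by omega) ih
  have : ∀ l, i ≤ l → f l ≤ f i := fun l hl => by
    induction l, hl using Nat.le_induction with
    | base => exact le_rfl
    | succ l hl ih => exact (hdesc l (by omega)).trans ih
  linarith [this q hiq]

/-- If the nonnegative terms of a sequence form an interval, then a quadratic polynomial separates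
them from the negative ones. -/
theorem exists_separating_quadratic {g : ℕ → ℝ} (N : ℕ)
    (h : ∀ p i q, 1 ≤ p → p ≤ i → i ≤ q → q ≤ N → 0 ≤ g p → 0 ≤ g q → 0 ≤ g i) :
    ∃ x y : ℝ, 0 < x * y ∧ ∀ i : ℕ, 1 ≤ i → i ≤ N → g i * ((i - x) * (i - y)) ≤ 0 := by
  set S := (Finset.Icc 1 N).filter fun i => 0 ≤ g i with hS
  rcases S.eq_empty_or_nonempty with hSe | hne
  · refine ⟨1, 1, by norm_num, fun i h1 h2 => ?_⟩
    have hi : g i < 0 := by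
      by_contra! hcon
      have : i ∈ S := by simp [hS, h1, h2, hcon]
      simp [hSe] at this
    exact mul_nonpos_of_nonpos_of_nonneg hi.le (mul_self_nonneg _)
  · have hp := Finset.mem_filter.1 (S.min'_mem hne)
    have hq := Finset.mem_filter.1 (S.max'_mem hne)
    set p := S.min' hne with hpdef
    set q := S.max' hne with hqdef
    rw [Finset.mem_Icc] at hp hq
    have hp1 : (1 : ℝ) ≤ p := by exact_mod_cast hp.1.1
    -- Half-integers just outside the block of nonnegative terms; since `p ≥ 1`, both are positive.
    refine ⟨p - 1 / 2, q + 1 / 2, mul_pos (by linarith) (by positivity), fun i h1 h2 => ?_⟩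
    rcases lt_or_ge (g i) 0 with hi | hi
    · refine mul_nonpos_of_nonpos_of_nonneg hi.le ?_
      rcases lt_or_ge i p with hip | hip
      · have h3 : (i : ℝ) + 1 ≤ p := by exact_mod_cast hip
        have h4 : (p : ℝ) ≤ q := by exact_mod_cast S.min'_le _ (S.max'_mem hne)
        exact mul_nonneg_of_nonpos_of_nonpos (by linarith) (by linarith)
      · rcases lt_or_ge q i with hqi | hqi
        · have h3 : (q : ℝ) + 1 ≤ i := by exact_mod_cast hqi
          have h4 : (p : ℝ) ≤ i := by exact_mod_cast hip
          exact mul_nonneg (by linarith) (by linarith)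
        · exact absurd (h p i q hp.1.1 hip hqi hq.1.2 hp.2 hq.2) (not_le.2 hi)
    · have hiS : i ∈ S := by simp [hS, h1, h2, hi]
      have h3 : (p : ℝ) ≤ i := by exact_mod_cast S.min'_le _ hiS
      have h4 : (i : ℝ) ≤ q := by exact_mod_cast S.le_max' _ hiS
      exact mul_nonpos_of_nonneg_of_nonpos hi
        (mul_nonpos_of_nonneg_of_nonpos (by linarith) (by linarith))

/-- The coefficients `C(m, 2i + 1) + 2 i K` are nonnegative on an interval of indices `i ≥ 1`. -/
theorem choose_odd_add_nonneg (m : ℕ) (K : ℝ) {p i q : ℕ} (hp : 1 ≤ p) (hpi : p ≤ i) (hiq : i ≤ q)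
    (h1 : 0 ≤ (m.choose (2 * p + 1) : ℝ) + 2 * p * K)
    (h2 : 0 ≤ (m.choose (2 * q + 1) : ℝ) + 2 * q * K) :
    0 ≤ (m.choose (2 * i + 1) : ℝ) + 2 * i * K := by
  have key : ∀ l : ℕ, 1 ≤ l → (0 ≤ (m.choose (2 * l + 1) : ℝ) + 2 * l * K ↔
      -K ≤ (m.choose (2 * l + 1) : ℝ) / (2 * l)) := fun l hl => by
    have : (1 : ℝ) ≤ l := by exact_mod_cast hl
    rw [le_div_iff₀ (by linarith)]
    constructor <;> intro h <;> linarith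
  rw [key p hp] at h1
  rw [key q (by omega)] at h2
  rw [key i (by omega)]
  by_contra! hcon
  exact absurd (lt_of_unimodal (f := fun l => (m.choose (2 * l + 1) : ℝ) / (2 * l))
    (fun j hj h => choose_odd_div_unimodal m hj h) hp hpi hiq h1 hcon) (not_lt.2 h2)

/-- The averaged function of the empty graph has no positive zero of multiplicity four. -/
theorem exists_bot_average_ne_zero (m N : ℕ) (hm : 0 < m) (K : ℝ) {μ : ℕ → ℝ}
    (hμ : ∀ i, 0 < μ i) {u : ℝ} (hu : 0 < u) :
    ∃ k < 4, ∑ i ∈ Finset.range (N + 1),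
      ((m.choose (2 * i + 1) : ℝ) + 2 * i * K) * μ i * (i : ℝ) ^ k * u ^ i ≠ 0 := by
  by_contra! hcon
  obtain ⟨x, y, hxy, hsep⟩ := exists_separating_quadratic
    (g := fun i => (m.choose (2 * i + 1) : ℝ) + 2 * i * K) N
    fun p i q hp hpi hiq _ h1 h2 => choose_odd_add_nonneg m K hp hpi hiq h1 h2
  set b : ℕ → ℝ := fun i => ((m.choose (2 * i + 1) : ℝ) + 2 * i * K) * μ i with hb
  -- The cubic weight with roots `1 / 2`, `x`, `y` follows the possible sign pattern `+ - + -`. A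
  -- quadruple zero makes every such weighted sum vanish, while here the terms with `i ≥ 1` are
  -- nonpositive and the term `i = 0` is negative.
  have hzero : ∑ i ∈ Finset.range (N + 1),
      b i * ((i - 1 / 2) * ((i - x) * (i - y))) * u ^ i = 0 := by
    have : ∀ i ∈ Finset.range (N + 1), b i * ((i - 1 / 2) * ((i - x) * (i - y))) * u ^ i =
        b i * (i : ℝ) ^ 3 * u ^ i - (1 / 2 + x + y) * (b i * (i : ℝ) ^ 2 * u ^ i) +
        ((x + y) / 2 + x * y) * (b i * (i : ℝ) ^ 1 * u ^ i) -
        (x * y / 2) * (b i * (i : ℝ) ^ 0 * u ^ i) := fun i _ => by ring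
    rw [Finset.sum_congr rfl this, Finset.sum_sub_distrib, Finset.sum_add_distrib,
      Finset.sum_sub_distrib, ← Finset.mul_sum, ← Finset.mul_sum, ← Finset.mul_sum,
      hcon 3 (by norm_num), hcon 2 (by norm_num), hcon 1 (by norm_num), hcon 0 (by norm_num)]
    ring
  rw [Finset.sum_range_succ'] at hzero
  have h1 : ∑ i ∈ Finset.range N, b (i + 1) * ((((i + 1 : ℕ) : ℝ) - 1 / 2) *
      ((((i + 1 : ℕ) : ℝ) - x) * (((i + 1 : ℕ) : ℝ) - y))) * u ^ (i + 1) ≤ 0 := by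
    refine Finset.sum_nonpos fun i hi => ?_
    have h2 := hsep (i + 1) (by omega) (Finset.mem_range.1 hi)
    have h3 : 0 ≤ μ (i + 1) * (((i + 1 : ℕ) : ℝ) - 1 / 2) * u ^ (i + 1) := by
      have := hμ (i + 1)
      have h4 : (0 : ℝ) ≤ ((i + 1 : ℕ) : ℝ) - 1 / 2 := by push_cast; linarith [i.cast_nonneg (α := ℝ)]
      positivity
    have := mul_nonpos_of_nonpos_of_nonneg h2 h3
    simp only [hb]
    linarith
  have h2 : b 0 * (((0 : ℕ) : ℝ) - 1 / 2) * ((((0 : ℕ) : ℝ) - x) * (((0 : ℕ) : ℝ) - y)) * u ^ 0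
      < 0 := by
    have h3 : 0 < b 0 := by
      simp only [hb, mul_zero, zero_add, Nat.choose_one_right, Nat.cast_zero, zero_mul, add_zero]
      exact mul_pos (by exact_mod_cast hm) (hμ 0)
    have := mul_pos h3 hxy
    simp only [Nat.cast_zero, zero_sub, pow_zero, mul_one]
    nlinarith
  linarith

/-- The averaged function of the complete graph has no positive zero of multiplicity four. -/
theorem exists_top_average_ne_zero {N : ℕ} (hN : 0 < N) {K C : ℝ} (hKC : K ≠ 0 ∨ C ≠ 0)
    {b μ : ℕ → ℝ} (hμ : ∀ i, 0 < μ i) (hb : ∀ i < N, b i = (2 * i + 1) * K * μ i)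
    (hbN : b N = C * μ N) {u : ℝ} (hu : 0 < u) :
    ∃ k < 4, ∑ i ∈ Finset.range (N + 1), b i * (i : ℝ) ^ k * u ^ i ≠ 0 := by
  by_contra! hcon
  have h0 := hcon 0 (by norm_num)
  have h1 := hcon 1 (by norm_num)
  have hzero : ∑ i ∈ Finset.range N, ((2 * i + 1) * μ i * ((N : ℝ) - i) * u ^ i) * K = 0 := by
    -- The weight `N - i` removes the top term, the only one whose sign may differ from that of `K`;
    -- vanishing to order two therefore already forces `K = 0`.
    have h2 : ∑ i ∈ Finset.range (N + 1), b i * ((N : ℝ) - i) * u ^ i = 0 := by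
      have : ∀ i ∈ Finset.range (N + 1), b i * ((N : ℝ) - i) * u ^ i =
          N * (b i * (i : ℝ) ^ 0 * u ^ i) - b i * (i : ℝ) ^ 1 * u ^ i := fun i _ => by ring
      rw [Finset.sum_congr rfl this, Finset.sum_sub_distrib, ← Finset.mul_sum, h0, h1]
      ring
    rw [Finset.sum_range_succ, sub_self, mul_zero, zero_mul, add_zero] at h2
    rw [← h2]
    refine Finset.sum_congr rfl fun i hi => ?_
    rw [hb i (Finset.mem_range.1 hi)]
    ring
  rw [← Finset.sum_mul] at hzero
  have hpos : 0 < ∑ i ∈ Finset.range N, (2 * (i : ℝ) + 1) * μ i * ((N : ℝ) - i) * u ^ i :=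
    Finset.sum_pos (fun i hi => by
      have := hμ i
      have h3 : (0 : ℝ) < (N : ℝ) - i := sub_pos.2 (by exact_mod_cast Finset.mem_range.1 hi)
      positivity) ⟨0, Finset.mem_range.2 hN⟩
  have hK : K = 0 := (mul_eq_zero.1 hzero).resolve_left hpos.ne'
  have hC := hKC.resolve_left (not_not.2 hK)
  rw [Finset.sum_range_succ, Finset.sum_eq_zero fun i hi => by
    rw [hb i (Finset.mem_range.1 hi), hK]; ring, hbN] at h0
  simp [hC, (hμ N).ne', hu.ne'] at h0

/-! ### Contradiction with the alternation of signs -/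

/-- If `N` limit cycles tend to circles, then the odd coefficients of `F` alternate in sign. -/
theorem IsAssociated.mul_succ_neg {V : Type*} [Fintype V] {W : Weights} {G : SimpleGraph V}
    {c : ℕ → ℝ} {N : ℕ} {r : Fin N → ℝ} (hr : ∀ j, 0 < r j) (hA : IsAssociated W G r)
    (hfield : ∀ ε, lienardField W G ε =
      fun p => (p.2 - ε * ∑ e ∈ Finset.range (2 * N + 1), c e * p.1 ^ (e + 1), -p.1))
    (hno : ∀ u > 0, ∃ k < 4, ∑ i ∈ Finset.range (N + 1),
      c (2 * i) * cosMean (2 * (i + 1)) * (i : ℝ) ^ k * u ^ i ≠ 0) {i : ℕ} (hi : i < N) :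
    c (2 * i) * c (2 * (i + 1)) < 0 := by
  have hfilter : ∀ j, (Finset.univ.filter fun i => r i ^ 2 = r j ^ 2) =
      Finset.univ.filter fun i => r i = r j := fun j =>
    Finset.filter_congr fun i _ => pow_left_inj₀ (hr i).le (hr j).le two_ne_zero
  have h := mul_succ_neg_of_roots (t := fun j => r j ^ 2) (fun j => pow_pos (hr j) 2)
    (fun j k hk4 hk => hA.average_eq_zero hfield (hr j) hk4 (by rwa [hfilter] at hk)) hno hi
  have h1 := mul_pos (cosMean_even_pos (i + 1)) (cosMean_even_pos (i + 1 + 1))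
  by_contra! hcon
  have := mul_nonneg hcon h1.le
  linarith

/-- Only the first and the last pair of consecutive coefficients are used: the first forces `2 K <
-C(m, 3)`, and this makes both members of the last pair negative. -/
theorem not_isAssociated_bot {N : ℕ} (hN : 2 ≤ N) (W : Weights) {r : Fin N → ℝ}
    (hr : ∀ j, 0 < r j) : ¬ IsAssociated W (⊥ : SimpleGraph (Fin (2 * N + 1))) r := by
  intro hA
  set K := defaultCoeff W (2 * N + 1) with hK
  have hfield : ∀ ε, lienardField W (⊥ : SimpleGraph (Fin (2 * N + 1))) ε =
      fun p => (p.2 - ε * ∑ e ∈ Finset.range (2 * N + 1),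
        diagCoeff W (⊥ : SimpleGraph (Fin (2 * N + 1))) (e + 1) * p.1 ^ (e + 1), -p.1) := fun ε => by
    have := lienardField_eq W (⊥ : SimpleGraph (Fin (2 * N + 1))) ε
    rwa [Fintype.card_fin] at this
  have hc : ∀ i ≤ N, diagCoeff W (⊥ : SimpleGraph (Fin (2 * N + 1))) (2 * i + 1) =
      ((2 * N + 1).choose (2 * i + 1) : ℝ) + 2 * i * K := fun i hi => by
    have := diagCoeff_bot_odd W (V := Fin (2 * N + 1)) (j := i) (by simp; omega)
    rwa [Fintype.card_fin] at this
  have halt : ∀ i < N, (((2 * N + 1).choose (2 * i + 1) : ℝ) + 2 * i * K) *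
      (((2 * N + 1).choose (2 * (i + 1) + 1) : ℝ) + 2 * (i + 1 : ℕ) * K) < 0 := fun i hi => by
    rw [← hc i hi.le, ← hc (i + 1) hi]
    refine hA.mul_succ_neg hr hfield (fun u hu => ?_) hi
    obtain ⟨k, hk, hne⟩ := exists_bot_average_ne_zero (2 * N + 1) N (by omega) K
      (fun i => cosMean_even_pos (i + 1)) hu
    refine ⟨k, hk, fun h0 => hne ?_⟩
    rw [← h0]
    refine Finset.sum_congr rfl fun i hi => ?_
    rw [hc i (Nat.lt_succ_iff.1 (Finset.mem_range.1 hi))]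
  obtain ⟨n, rfl⟩ : ∃ n, N = n + 2 := ⟨N - 2, by omega⟩
  have hn : (0 : ℝ) ≤ n := n.cast_nonneg
  have h0 := halt 0 (by omega)
  have h1 := halt (n + 1) (by omega)
  have e0 := choose_odd_succ_mul_real (2 * (n + 2) + 1) 0
  have etop : (2 * (n + 2) + 1).choose (2 * (n + 1 + 1) + 1) = 1 := Nat.choose_self _
  have epen : ((2 * (n + 2) + 1).choose (2 * (n + 1) + 1) : ℝ) = (2 * n + 5) * (n + 2) := by
    rw [Nat.choose_symm_of_eq_add (show 2 * (n + 2) + 1 = 2 * (n + 1) + 1 + 2 by ring),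
      Nat.cast_choose_two]
    push_cast
    ring
  rw [etop, epen] at h1
  simp only [mul_zero, zero_add, Nat.choose_one_right, Nat.cast_zero, zero_mul, add_zero] at h0 e0
  push_cast at h0 h1 e0
  set A : ℝ := ((2 * (n + 2) + 1).choose (2 * 1 + 1) : ℝ)
  have hA3 : A * 3 = (2 * n + 5) * (n + 2) * (2 * n + 3) := by linarith
  have hK3 : A + 2 * K < 0 := by
    by_contra! hcon
    have : 0 ≤ (2 * ((n : ℝ) + 2) + 1) * (A + 2 * K) := by positivity
    linarith
  have hA0 : 0 ≤ A := Nat.cast_nonneg _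
  have hlast : (1 : ℝ) + 2 * (n + 1 + 1) * K < 0 := by
    have : 1 ≤ A := by nlinarith
    nlinarith
  have hpen : (2 * (n : ℝ) + 5) * (n + 2) + 2 * (n + 1) * K < 0 := by
    -- By the formula for `3 A`, this reduces to `(n + 1) * (2 n + 3) - 3 = n * (2 n + 5) ≥ 0`, with
    -- equality for `n = 0`, where the penultimate coefficient is the second one.
    have : (2 * (n : ℝ) + 5) * (n + 2) ≤ (n + 1) * A := by
      have h3 : 0 ≤ (2 * (n : ℝ) + 5) * (n + 2) * (n * (2 * n + 5)) := by positivity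
      nlinarith
    nlinarith
  linarith [mul_pos_of_neg_of_neg hpen hlast]

theorem not_isAssociated_top {N : ℕ} (hN : 2 ≤ N) (W : Weights) {r : Fin N → ℝ}
    (hr : ∀ j, 0 < r j) : ¬ IsAssociated W (⊤ : SimpleGraph (Fin (2 * N + 1))) r := by
  intro hA
  set K := defaultCoeff W (2 * N + 1) with hK
  set c : ℕ → ℝ := fun e => diagCoeff W (⊤ : SimpleGraph (Fin (2 * N + 1))) (e + 1) with hcdef
  have hfield : ∀ ε, lienardField W (⊤ : SimpleGraph (Fin (2 * N + 1))) ε =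
      fun p => (p.2 - ε * ∑ e ∈ Finset.range (2 * N + 1), c e * p.1 ^ (e + 1), -p.1) := fun ε => by
    have := lienardField_eq W (⊤ : SimpleGraph (Fin (2 * N + 1))) ε
    rwa [Fintype.card_fin] at this
  have hc : ∀ e < 2 * N, c e = (e + 1) * K := fun e he => by
    have := diagCoeff_top W (V := Fin (2 * N + 1)) (d := e + 1) (by simp; omega) (by omega)
    rw [Fintype.card_fin] at this
    rw [hcdef]
    push_cast at this
    exact this
  by_cases hKC : K ≠ 0 ∨ c (2 * N) ≠ 0
  · have halt := hA.mul_succ_neg hr hfield (fun u hu =>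
      exists_top_average_ne_zero (by omega) hKC (fun i => cosMean_even_pos (i + 1))
        (fun i hi => by rw [hc _ (by omega)]; push_cast; ring) rfl hu) (i := 0) (by omega)
    -- The product of the first two coefficients is `3 * K ^ 2`; `N ≥ 2` keeps the second one below
    -- the top degree.
    rw [hc _ (by omega), hc _ (by omega)] at halt
    push_cast at halt
    nlinarith [sq_nonneg K]
  -- Now the even-degree coefficients vanish as well, so the damping is identically zero and a
  -- single cycle is already impossible.
  · push Not at hKC
    have hzero : ∀ e ∈ Finset.range (2 * N + 1), c e = 0 := fun e he => by
      rcases (Nat.lt_succ_iff.1 (Finset.mem_range.1 he)).lt_or_eq with h | rfl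
      · rw [hc e h, hKC.1, mul_zero]
      · exact hKC.2
    obtain ⟨Γ, hcyc, -⟩ := hA
    obtain ⟨ε, hcl, -⟩ := hcyc.exists
    refine not_isLimitCycle_center (Γ ⟨0, by omega⟩ ε) ?_
    have hcenter : lienardField W (⊤ : SimpleGraph (Fin (2 * N + 1))) ε =
        fun p : ℝ × ℝ => (p.2, -p.1) := by
      rw [hfield]
      funext p
      rw [Finset.sum_eq_zero fun e he => by rw [hzero e he, zero_mul], mul_zero, sub_zero]
    rw [← hcenter]
    exact hcl _

end BoundaryLienard

theorem theorem2p2 (m : ℕ) (hm : Odd m) (hm3 : 3 < m) (W : BoundaryLienard.Weights)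
    (r : Fin ((m - 1) / 2) → ℝ) (hr : ∀ j, 0 < r j) :
    ¬ BoundaryLienard.IsAssociated W (⊤ : SimpleGraph (Fin m)) r ∧
    ¬ BoundaryLienard.IsAssociated W (⊥ : SimpleGraph (Fin m)) r := by
  obtain ⟨N, rfl⟩ := hm
  revert r
  rw [show (2 * N + 1 - 1) / 2 = N by omega]
  intro r hr
  exact ⟨BoundaryLienard.not_isAssociated_top (by omega) W hr,
    BoundaryLienard.not_isAssociated_bot (by omega) W hr⟩
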